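/- Let $V_1,V_2,\ldots$ and $W_1,W_2,\ldots$ be i.i.d. standard Gaussian $\mathcal N(0,1)$ random variables, the two sequences being independent of each other. Fix $0<s<\infty$, $0<\varepsilon<\infty$, $p\ge 1$ and $q\in(1/2,1)$. Let $X_t=\sum_{i=1}^t V_i+st$ and $Y_t=X_t+\varepsilon\sum_{i=1}^t W_i$ for integers $t\ge 0$ (so $X_0=Y_0=0$), and for a real level $\ell>0$ let $\tau_\ell=\inf\{t\ge 0: X_t\ge \ell\}$. Let $$\hat X_t=\frac{1}{1+\varepsilon^2}Y_t+\frac{s\varepsilon^2}{1+\varepsilon^2}t$$ (the minimum mean square error estimator of $X_t$ from $Y_t$), let $t^\star=\lfloor \ell/s-(\ell/s)^q\rfloor$ (read as $0$ if this is negative), and define $$\eta^{\circledast}_\ell=\inf\{t\ge 0:\hat X_t\ge \ell\},\qquad \eta^\star_\ell=t^\star+\left\lfloor\frac{(\ell-\hat X_{t^\star})_+}{s}\right\rfloor .$$ Then $\eta^{\circledast}_\ell$ and $\eta^\star_\ell$ are stopping times with respect to the natural filtration of $Y$, and for $\eta=\eta^{\circledast}_\ell$ as well as for $\eta=\eta^\star_\ell$,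 $$\mathbb E|\eta-\tau_\ell|^p=(1+o(1))\inf_{\eta'}\mathbb E|\eta'-\tau_\ell|^p=(1+o(1))\,C_1(\ell,s,\varepsilon,p)\qquad(\ell\to\infty),$$ where the infimum is over all measurable functions $\eta'=\eta'(Y_0,Y_1,Y_2,\ldots)$ of the entire observation process (not necessarily stopping times), and $$C_1(\ell,s,\varepsilon,p)=\left(\frac{\ell\varepsilon^2}{s^3(1+\varepsilon^2)}\right)^{p/2}\mathbb E|N|^p,\qquad N\sim\mathcal N(0,1).$$ -/

import Mathlib

open MeasureTheory ProbabilityTheory Filter Topology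
open scoped ENNReal

namespace NoisyTracking

noncomputable section

/-- The random walk with drift `X_t = ∑_{i=1}^t V_i + s t`, `X_0 = 0`
(`V i` stands for the increment `V_{i+1}`). -/
def walk {Ω : Type*} (s : ℝ) (V : ℕ → Ω → ℝ) (t : ℕ) (ω : Ω) : ℝ :=
  ∑ i ∈ Finset.range t, V i ω + s * t

/-- The observation process `Y_t = X_t + ε ∑_{i=1}^t W_i`, `Y_0 = 0`. -/
def obs {Ω : Type*} (s ε : ℝ) (V W : ℕ → Ω → ℝ) (t : ℕ) (ω : Ω) : ℝ :=
  walk s V t ω + ε * ∑ i ∈ Finset.range t, W i ω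

/-- The minimum mean square error estimate of `X_t` from the observed value `y = Y_t`:
`y / (1 + ε²) + s ε² t / (1 + ε²)`. -/
def mmse (s ε : ℝ) (t : ℕ) (y : ℝ) : ℝ :=
  1 / (1 + ε ^ 2) * y + s * ε ^ 2 / (1 + ε ^ 2) * t

/-- First passage time `inf {t ≥ 0 : Z_t ≥ l}`, equal to `⊤` if the level is never reached. -/
def firstPassage {Ω : Type*} (Z : ℕ → Ω → ℝ) (l : ℝ) : Ω → WithTop ℕ :=
  hittingAfter Z (Set.Ici l) 0

/-- The sequential rule, as a function of the observation process `Y`: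
stop as soon as the estimate of `X_t` reaches the level. -/
def seqRule {Ω : Type*} (s ε : ℝ) (Y : ℕ → Ω → ℝ) (l : ℝ) : Ω → WithTop ℕ :=
  firstPassage (fun t ω => mmse s ε t (Y t ω)) l

/-- The single observation instant `⌊l/s - (l/s)^q⌋` (and `0` if this is negative). -/
def singleTime (s q l : ℝ) : ℕ := ⌊l / s - (l / s) ^ q⌋₊

/-- The single-observation rule `t + ⌊(l - X̂_t)₊ / s⌋` with `t = singleTime s q l`,
as a function of the observation process `Y`. -/
def singleRule {Ω : Type*} (s ε q : ℝ) (Y : ℕ → Ω → ℝ) (l : ℝ) (ω : Ω) : WithTop ℕ :=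
  ((singleTime s q l +
    ⌊max 0 (l - mmse s ε (singleTime s q l) (Y (singleTime s q l) ω)) / s⌋₊ : ℕ) : WithTop ℕ)

/-- A possibly infinite time as an extended real number. -/
def timeToEReal : WithTop ℕ → EReal
  | ⊤ => ⊤
  | (n : ℕ) => ((n : ℝ) : EReal)

/-- `E |A - B|^p` in `[0, ∞]` (the difference counts as infinite where `A` or `B` is). -/
def absMoment {Ω : Type*} [MeasurableSpace Ω] (P : Measure Ω) (p : ℝ) (A B : Ω → EReal) : ℝ≥0∞ :=
  ∫⁻ ω, (A ω - B ω).abs ^ p ∂P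

/-- `E |η - τ_l|^p`, where `τ_l` is the first time the walk reaches level `l`. -/
def risk {Ω : Type*} [MeasurableSpace Ω] (P : Measure Ω) (p s : ℝ) (V : ℕ → Ω → ℝ) (l : ℝ)
    (η : Ω → EReal) : ℝ≥0∞ :=
  absMoment P p η (fun ω => timeToEReal (firstPassage (walk s V) l ω))

/-- The infimum of `E |η - τ_l|^p` over all estimators `η = f(Y_0, Y_1, …)`, where `f` is an
arbitrary (measurable) function of the entire observation process. -/
def bestRisk {Ω : Type*} [MeasurableSpace Ω] (P : Measure Ω) (p s ε : ℝ) (V W : ℕ → Ω → ℝ)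
    (l : ℝ) : ℝ≥0∞ :=
  ⨅ f : {f : (ℕ → ℝ) → EReal // Measurable f},
    risk P p s V l (fun ω => f.1 (fun t => obs s ε V W t ω))

/-- `C₁(l, s, ε, p) = (l ε² / (s³ (1 + ε²)))^{p/2} E|N|^p` with `N` standard Gaussian. -/
def C1 (l s ε p : ℝ) : ℝ≥0∞ :=
  ENNReal.ofReal ((l * ε ^ 2 / (s ^ 3 * (1 + ε ^ 2))) ^ (p / 2)) *
    ∫⁻ x, ENNReal.ofReal (|x| ^ p) ∂(gaussianReal 0 1)

lemma stronglyMeasurable_obs {Ω : Type*} [MeasurableSpace Ω] (s ε : ℝ) {V W : ℕ → Ω → ℝ}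
    (hV : ∀ i, Measurable (V i)) (hW : ∀ i, Measurable (W i)) (t : ℕ) :
    StronglyMeasurable (obs s ε V W t) := by
  apply Measurable.stronglyMeasurable
  unfold obs walk
  fun_prop

/-- The natural filtration of the observation process. -/
def obsFiltration {Ω : Type*} [MeasurableSpace Ω] (s ε : ℝ) {V W : ℕ → Ω → ℝ}
    (hV : ∀ i, Measurable (V i)) (hW : ∀ i, Measurable (W i)) :
    Filtration ℕ (inferInstance : MeasurableSpace Ω) :=
  Filtration.natural (obs s ε V W) (stronglyMeasurable_obs s ε hV hW)

end

end NoisyTracking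

/-!
All processes are followed through their value at the time `m = ⌊l/s - (l/s)^q⌋`.

A Gaussian walk `Z_t = S_t + s t` first reaches the level `l` at a time equal to
`m + (l - Z_m) / s`, up to an error that is `o(√l)` in `L^p`
(`IsGaussianWalk.tendsto_eLpNorm_firstPassage_sub`). The reason is pathwise. Fix `a` with
`1/2 < a < 1/(2q)`. There is a random constant `c`, with any prescribed number of moments bounded
uniformly in `m`, with `|S_t - S_m| ≤ c (|t - m| + 1) ^ a` for all `t`; it is a root of a sum over
`t` of high powers (`envelope`), and its moments are finite because `a > 1/2`. Both the overshoot
and the fluctuation after `m` are at most a constant plus `c (|τ - m| + 2) ^ a`, while `|τ - m|` is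
of order `(l/s)^q`, so the error is
of order `l ^ (q a)` with `q a < 1/2`. No stopping time argument is needed.

The process `X`, and also the estimate `X̂`, is such a walk. Hence the passage time `τ` of `X` is
`m + (l - X_m) / s`, and the sequential rule is `m + (l - X̂_m) / s`, both up to `o(√l)`. The same
holds for the single-observation rule, where only rounding and a truncation at `0` have to be
controlled (`IsGaussianWalk.tendsto_eLpNorm_floor_sub`). So for both rules `η - τ` is
`(X_m - X̂_m) / s` up to `o(√l)` in `L^p`; this variable is Gaussian with variance
`m ε² / ((1 + ε²) s²)`, and its `p`-th absolute moment is asymptotic to `C₁`.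

For the lower bound, `X_m - X̂_m` is independent of the whole process `Y`, because the increments
`V_i + ε W_i` are uncorrelated with `ε V_i - W_i` (`indepFun_rotated`). A symmetric variable that is
independent of `Y` is not better approximated by any function of `Y` than by `0`
(`eLpNorm_le_eLpNorm_sub_of_indepFun`). So every estimator has risk at least
`(‖(X_m - X̂_m) / s‖_p - o(√l)) ^ p`.
-/

namespace NoisyTracking

/-! ### Pathwise analysis of first passage times -/

lemma firstPassage_eq_coe {Ω : Type*} (Z : ℕ → Ω → ℝ) (l : ℝ) (ω : Ω) (h : ∃ t, l ≤ Z t ω) :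
    ∃ n : ℕ, firstPassage Z l ω = n ∧ l ≤ Z n ω ∧ ∀ k < n, Z k ω < l := by
  classical
  refine ⟨Nat.find h, ?_, Nat.find_spec h, fun k hk => not_le.1 (Nat.find_min h hk)⟩
  apply le_antisymm
  · exact hittingAfter_le_of_mem (Nat.zero_le _) (Nat.find_spec h)
  · by_contra hlt
    obtain ⟨j, hj, hj'⟩ := (hittingAfter_lt_iff).1 (not_le.1 hlt)
    exact Nat.find_min h hj.2 hj'

/-- Within a sublinear envelope the drift wins, so every level is reached. -/
lemma exists_level_le_of_envelope {S : ℕ → ℝ} {s l c a : ℝ} {m : ℕ} (hs : 0 < s)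
    (ha1 : a < 1)
    (hB : ∀ t : ℕ, |S t - S m| ≤ c * (|(t : ℝ) - m| + 1) ^ a) :
    ∃ t : ℕ, l ≤ S t + s * t := by
  have h1 : Tendsto (fun k : ℕ => c * ((k : ℝ) + 1) ^ (-(1 - a))) atTop (𝓝 0) := by
    have := ((tendsto_rpow_neg_atTop (y := 1 - a) (by linarith)).comp
      (tendsto_atTop_add_const_right _ (1 : ℝ) tendsto_natCast_atTop_atTop)).const_mul c
    simpa [Function.comp_def] using this
  have h2 : ∀ᶠ k : ℕ in atTop, c * ((k : ℝ) + 1) ^ (-(1 - a)) < s / 2 :=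
    h1.eventually (gt_mem_nhds (by positivity))
  have h3 : ∀ᶠ k : ℕ in atTop, 2 * (l - S m - s * m + s) / s ≤ (k : ℝ) :=
    tendsto_natCast_atTop_atTop.eventually (eventually_ge_atTop _)
  obtain ⟨k, hk2, hk3⟩ := (h2.and h3).exists
  refine ⟨m + k, ?_⟩
  have hx : (0 : ℝ) < (k : ℝ) + 1 := by positivity
  have hb := hB (m + k)
  have e1 : |((m + k : ℕ) : ℝ) - m| + 1 = (k : ℝ) + 1 := by
    push_cast; rw [add_sub_cancel_left, abs_of_nonneg (by positivity)]
  rw [e1] at hb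
  have e2 : ((k : ℝ) + 1) ^ a = ((k : ℝ) + 1) ^ (-(1 - a)) * ((k : ℝ) + 1) := by
    rw [← Real.rpow_add_one hx.ne']; congr 1; ring
  rw [e2, ← mul_assoc] at hb
  have h4 := mul_lt_mul_of_pos_right hk2 hx
  rw [div_le_iff₀ hs] at hk3
  have := (abs_le.1 hb).1
  push_cast
  nlinarith

/-- With an overshoot controlled by the envelope, `y = T - L / s` obeys `|y| ≤ c₁ (|T| + 2) ^ a`;
since `a < 1` this self-referential bound can be resolved in terms of `L` alone. -/
lemma firstPassage_error_le {S : ℕ → ℝ} {s l c a : ℝ} {m n : ℕ} (hs : 0 < s)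
    (ha0 : 0 < a) (ha1 : a < 1) (hc : 0 ≤ c)
    (hB : ∀ t : ℕ, |S t - S m| ≤ c * (|(t : ℝ) - m| + 1) ^ a)
    (hn0 : n ≠ 0) (hn : l ≤ S n + s * n) (hlt : ∀ k < n, S k + s * k < l) :
    |(n : ℝ) - (m + (l - (S m + s * m)) / s)| ≤
      (1 + c / s) * (2 * |l - (S m + s * m)| / s + 4) ^ a +
        (2 * (1 + c / s)) ^ (1 / (1 - a)) := by
  set L := l - (S m + s * m) with hL
  set T : ℝ := (n : ℝ) - m with hT
  set x : ℝ := |T| + 2 with hx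
  have hx2 : 2 ≤ x := by rw [hx]; linarith [abs_nonneg T]
  have hxa : 1 ≤ x ^ a := Real.one_le_rpow (by linarith) ha0.le
  set c1 := 1 + c / s with hc1
  have hcs : 0 ≤ c / s := by positivity
  have hd1 : |S n - S m| ≤ c * x ^ a := (hB n).trans (by gcongr; linarith)
  have hd2 : |S (n - 1) - S m| ≤ c * x ^ a := by
    refine (hB (n - 1)).trans ?_
    have h1 : ((n - 1 : ℕ) : ℝ) - m = T - 1 := by
      rw [Nat.cast_sub (by omega)]; push_cast; ring
    rw [h1]
    gcongr
    have := abs_sub T 1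
    rw [abs_one] at this
    linarith
  have hlast := hlt (n - 1) (by omega)
  have hcast : ((n - 1 : ℕ) : ℝ) = (n : ℝ) - 1 := by
    rw [Nat.cast_sub (by omega)]; push_cast; ring
  rw [hcast] at hlast
  have he : |T - L / s| ≤ c1 * x ^ a := by
    rw [abs_le]
    have e : c1 * x ^ a = x ^ a + c * x ^ a / s := by rw [hc1]; ring
    rw [e]
    have e3 : T - L / s = (s * T - L) / s := by field_simp
    rw [e3]
    have b1 : -(c * x ^ a) ≤ s * T - L := by
      have := (abs_le.1 hd1).2
      rw [hL, hT]; nlinarith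
    have b2 : s * T - L ≤ s + c * x ^ a := by
      have := (abs_le.1 hd2).1
      rw [hL, hT]; nlinarith
    constructor
    · have : -(c * x ^ a) / s ≤ (s * T - L) / s := by gcongr
      rw [neg_div] at this
      linarith
    · have : (s * T - L) / s ≤ (s + c * x ^ a) / s := by gcongr
      rw [add_div, div_self hs.ne'] at this
      linarith
  have hgoal : (n : ℝ) - (m + L / s) = T - L / s := by rw [hT]; ring
  rw [hgoal]
  have hTle : x ≤ |L| / s + 2 + c1 * x ^ a := by
    have h1 : |T| ≤ |T - L / s| + |L / s| := by
      have := abs_add_le (T - L / s) (L / s)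
      simpa using this
    rw [abs_div, abs_of_pos hs] at h1
    linarith
  have hc1p : 1 ≤ c1 := by linarith
  rcases le_total (c1 * x ^ a) (x / 2) with h | h
  · have hxA : x ≤ 2 * |L| / s + 4 := by
      have : 2 * |L| / s = 2 * (|L| / s) := by ring
      linarith
    have h1 : c1 * x ^ a ≤ c1 * (2 * |L| / s + 4) ^ a := by gcongr
    have h2 : 0 ≤ (2 * c1) ^ (1 / (1 - a)) := by positivity
    linarith
  · have h1 : x ^ (1 - a) ≤ 2 * c1 := by
      have e : x = x ^ (1 - a) * x ^ a := by
        rw [← Real.rpow_add (by linarith)]; simp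
      have : x ^ (1 - a) * x ^ a ≤ (2 * c1) * x ^ a := by rw [← e]; linarith
      exact le_of_mul_le_mul_right this (by linarith)
    have h2 : x ≤ (2 * c1) ^ (1 / (1 - a)) := by
      have := Real.rpow_le_rpow (by positivity) h1 (z := 1 / (1 - a)) (by
        apply div_nonneg <;> linarith)
      rwa [← Real.rpow_mul (by linarith), mul_one_div_cancel (by linarith), Real.rpow_one] at this
    have h3 : c1 * x ^ a ≤ (2 * c1) ^ (1 / (1 - a)) := by
      calc c1 * x ^ a ≤ (2 * c1) * ((2 * c1) ^ (1 / (1 - a))) ^ a := by gcongr; linarith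
        _ = (2 * c1) ^ (1 / (1 - a)) := by
          rw [← Real.rpow_mul (by positivity), mul_comm (2 * c1),
            ← Real.rpow_add_one (by positivity)]
          congr 1
          field_simp [show (1 : ℝ) - a ≠ 0 by linarith]
          ring
    have h4 : 0 ≤ c1 * (2 * |L| / s + 4) ^ a := by positivity
    linarith

/-- The error of the linear prediction in terms of quantities with bounded moments: the constant
`c` of the envelope and the normalized position `|S m| / (l / s) ^ q`. The remaining factor has the
order `l ^ (q a)`. -/
lemma firstPassage_error_le_moments {S : ℕ → ℝ} {s l c a q : ℝ} {m n : ℕ} (hs : 0 < s)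
    (ha0 : 1 / 2 < a) (ha1 : a < 1) (hc : 0 ≤ c) (hq : 0 < q) (hl : s ≤ l)
    (hm : |l / s - m| ≤ (l / s) ^ q + 1)
    (hB : ∀ t : ℕ, |S t - S m| ≤ c * (|(t : ℝ) - m| + 1) ^ a)
    (hn0 : n ≠ 0) (hn : l ≤ S n + s * n) (hlt : ∀ k < n, S k + s * k < l) :
    |(n : ℝ) - (m + (l - (S m + s * m)) / s)| ≤
      (2 * 4 ^ (1 / (1 - a)) + 2 * (4 / s) ^ (1 / (1 - a)) + 128 + 8 / s ^ 2) *
        (l / s) ^ (q * a) * (1 + c ^ (1 / (1 - a)) + (|S m| / (l / s) ^ q) ^ 2) := by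
  refine (firstPassage_error_le hs (by linarith) ha1 hc hB hn0 hn hlt).trans ?_
  set k := 1 / (1 - a) with hk
  have hk2 : 2 ≤ k := by
    rw [hk, le_div_iff₀ (by linarith)]; linarith
  set u := l / s with hu
  have hu1 : 1 ≤ u := by rw [hu, le_div_iff₀ hs]; linarith
  have huq : 1 ≤ u ^ q := Real.one_le_rpow hu1 hq.le
  set N := |S m| / u ^ q with hN
  have hN0 : 0 ≤ N := by positivity
  have hSm : |S m| = u ^ q * N := by rw [hN]; field_simp
  set w := u ^ (q * a) with hw
  have hw1 : 1 ≤ w := Real.one_le_rpow hu1 (by nlinarith)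
  have hL : |l - (S m + s * m)| ≤ s * (u ^ q + 1) + u ^ q * N := by
    have e : l - (S m + s * m) = s * (u - m) + - S m := by
      rw [hu]; field_simp; ring
    rw [e]
    refine (abs_add_le _ _).trans ?_
    rw [abs_mul, abs_of_pos hs, abs_neg, hSm]
    gcongr
  set b := 8 + 2 * N / s with hb
  have hb1 : 1 ≤ b := by
    have : 0 ≤ 2 * N / s := by positivity
    linarith
  have hA : 2 * |l - (S m + s * m)| / s + 4 ≤ u ^ q * b := by
    have h1 : 2 * |l - (S m + s * m)| / s ≤ 2 * (s * (u ^ q + 1) + u ^ q * N) / s := by gcongr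
    have h2 : 2 * (s * (u ^ q + 1) + u ^ q * N) / s = 2 * u ^ q + 2 + u ^ q * (2 * N / s) := by
      field_simp
    rw [hb, mul_add]
    linarith
  have hAa : (2 * |l - (S m + s * m)| / s + 4) ^ a ≤ w * b := by
    calc _ ≤ (u ^ q * b) ^ a := by gcongr
      _ = w * b ^ a := by
        rw [Real.mul_rpow (by positivity) (by positivity), ← Real.rpow_mul (by linarith)]
      _ ≤ w * b := by
        gcongr
        exact (Real.rpow_le_rpow_of_exponent_le hb1 ha1.le).trans_eq (Real.rpow_one b)
  set c1 := 1 + c / s with hc1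
  have hcs : 0 ≤ c / s := by positivity
  have hc1' : 1 ≤ c1 := by linarith
  have hsq : c1 ^ 2 ≤ (2 * c1) ^ k := by
    calc c1 ^ 2 ≤ (2 * c1) ^ 2 := by gcongr; linarith
      _ = (2 * c1) ^ (2 : ℝ) := by norm_num
      _ ≤ (2 * c1) ^ k := Real.rpow_le_rpow_of_exponent_le (by linarith) hk2
  have hc1k : (2 * c1) ^ k ≤ 4 ^ k + (4 / s) ^ k * c ^ k := by
    rw [← Real.mul_rpow (by positivity) hc]
    have p1 : (0 : ℝ) ≤ 4 ^ k := by positivity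
    have p2 : (0 : ℝ) ≤ (4 / s * c) ^ k := by positivity
    have e : 4 / s * c = 4 * (c / s) := by ring
    rcases le_total (c / s) 1 with h | h
    · have : (2 * c1) ^ k ≤ 4 ^ k := by gcongr; linarith
      linarith
    · have h2 : 2 * c1 ≤ 4 / s * c := by rw [e]; linarith
      have : (2 * c1) ^ k ≤ (4 / s * c) ^ k :=
        Real.rpow_le_rpow (by positivity) h2 (by linarith)
      linarith
  have hcb : c1 * b ≤ c1 ^ 2 + b ^ 2 := by nlinarith [sq_nonneg (c1 - b), sq_nonneg c1, sq_nonneg b]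
  have hb2 : b ^ 2 ≤ 128 + 8 / s ^ 2 * N ^ 2 := by
    have e : 8 / s ^ 2 * N ^ 2 = 2 * (2 * N / s) ^ 2 := by field_simp; ring
    rw [e, hb]
    nlinarith [sq_nonneg (8 - 2 * N / s)]
  have hck : 0 ≤ c ^ k := by positivity
  have hq4 : (0 : ℝ) ≤ 4 ^ k := by positivity
  have hqs : (0 : ℝ) ≤ (4 / s) ^ k := by positivity
  have hs8 : (0 : ℝ) ≤ 8 / s ^ 2 := by positivity
  have hmain : c1 * b + (2 * c1) ^ k ≤
      (2 * 4 ^ k + 2 * (4 / s) ^ k + 128 + 8 / s ^ 2) * (1 + c ^ k + N ^ 2) := by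
    have h1 : c1 * b + (2 * c1) ^ k ≤
        2 * 4 ^ k + 2 * ((4 / s) ^ k * c ^ k) + 128 + 8 / s ^ 2 * N ^ 2 := by linarith
    refine h1.trans ?_
    generalize (4 : ℝ) ^ k = A at *
    generalize (4 / s) ^ k = B at *
    generalize c ^ k = x at *
    generalize 8 / s ^ 2 = D at *
    have : 0 ≤ (2 * A + 128) * (x + N ^ 2) + 2 * B * (1 + N ^ 2) + D * (1 + x) := by positivity
    linarith
  have hk0 : 0 ≤ (2 * c1) ^ k := by positivity
  calc c1 * (2 * |l - (S m + s * m)| / s + 4) ^ a + (2 * c1) ^ k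
      ≤ c1 * (w * b) + w * (2 * c1) ^ k := by
        gcongr
        nlinarith
    _ = w * (c1 * b + (2 * c1) ^ k) := by ring
    _ ≤ w * ((2 * 4 ^ k + 2 * (4 / s) ^ k + 128 + 8 / s ^ 2) * (1 + c ^ k + N ^ 2)) := by
        gcongr
    _ = _ := by ring

/-! ### Gaussian walks and their envelopes -/

lemma enorm_rpow_eq_ofReal (x : ℝ) {p : ℝ} (hp : 0 ≤ p) : ‖x‖ₑ ^ p = ENNReal.ofReal (|x| ^ p) := by
  rw [Real.enorm_eq_ofReal_abs, ENNReal.ofReal_rpow_of_nonneg (abs_nonneg x) hp]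

/-- The absolute moment `E |N| ^ r` of a standard Gaussian `N`. -/
noncomputable def gaussianAbsMoment (r : ℝ) : ℝ≥0∞ :=
  ∫⁻ x, ENNReal.ofReal (|x| ^ r) ∂(gaussianReal 0 1)

lemma gaussianAbsMoment_lt_top {r : ℝ} (hr : 0 < r) : gaussianAbsMoment r < ∞ := by
  have h := memLp_id_gaussianReal' (μ := 0) (v := 1) (ENNReal.ofReal r) ENNReal.ofReal_ne_top
  have h2 := lintegral_rpow_enorm_lt_top_of_eLpNorm_lt_top (by simpa using hr)
    ENNReal.ofReal_ne_top h.eLpNorm_lt_top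
  rw [ENNReal.toReal_ofReal hr.le] at h2
  simpa only [gaussianAbsMoment, id_eq, enorm_rpow_eq_ofReal _ hr.le] using h2

lemma gaussianAbsMoment_pos {r : ℝ} : 0 < gaussianAbsMoment r := by
  rw [gaussianAbsMoment, lintegral_pos_iff_support (by fun_prop)]
  have : {(0 : ℝ)}ᶜ ⊆ Function.support fun x : ℝ => ENNReal.ofReal (|x| ^ r) := by
    intro x hx
    have : 0 < |x| ^ r := Real.rpow_pos_of_pos (abs_pos.2 hx) r
    simpa using this
  refine lt_of_lt_of_le ?_ (measure_mono this)
  have h0 : gaussianReal 0 1 {(0 : ℝ)} = 0 :=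
    (gaussianReal_absolutelyContinuous 0 one_ne_zero) (by simp)
  rw [prob_compl_eq_one_sub (measurableSet_singleton 0), h0]
  simp

lemma lintegral_abs_rpow_of_map_eq {Ω : Type*} [MeasurableSpace Ω] {P : Measure Ω} {X : Ω → ℝ}
    {v : NNReal} (hX : Measurable X) (h : P.map X = gaussianReal 0 v) {r : ℝ} :
    ∫⁻ ω, ENNReal.ofReal (|X ω| ^ r) ∂P =
      ENNReal.ofReal ((v : ℝ) ^ (r / 2)) * gaussianAbsMoment r := by
  have h1 : ∫⁻ ω, ENNReal.ofReal (|X ω| ^ r) ∂P =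
      ∫⁻ x, ENNReal.ofReal (|x| ^ r) ∂(gaussianReal 0 v) := by
    rw [← h, lintegral_map (by fun_prop) hX]
  have h2 : gaussianReal 0 v = (gaussianReal 0 1).map (fun x => √(v : ℝ) * x) := by
    rw [gaussianReal_map_const_mul]
    congr 1
    · simp
    · ext; simp
  rw [h1, h2, lintegral_map (by fun_prop) (by fun_prop), gaussianAbsMoment,
    ← lintegral_const_mul _ (by fun_prop)]
  refine lintegral_congr fun x => ?_
  rw [← ENNReal.ofReal_mul (by positivity), abs_mul, Real.mul_rpow (by positivity) (by positivity),
    abs_of_nonneg (Real.sqrt_nonneg _), Real.sqrt_eq_rpow, ← Real.rpow_mul (by positivity)]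
  congr 3
  ring

/-- A centered Gaussian random walk with variance `v` per step: it starts at `0` and the increment
over `k` steps has law `N(0, v k)`. Independence of the increments is not part of the definition. -/
structure IsGaussianWalk {Ω : Type*} [MeasurableSpace Ω] (P : Measure Ω) (v : NNReal)
    (S : ℕ → Ω → ℝ) : Prop where
  measurable : ∀ t, Measurable (S t)
  zero : ∀ ω, S 0 ω = 0
  map_increment : ∀ m k : ℕ, P.map (fun ω => S (m + k) ω - S m ω) = gaussianReal 0 (v * k)

namespace IsGaussianWalk

variable {Ω : Type*} [MeasurableSpace Ω] {P : Measure Ω} {v : NNReal} {S : ℕ → Ω → ℝ}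

lemma measurable_sub (hS : IsGaussianWalk P v S) (t m : ℕ) :
    Measurable fun ω => S t ω - S m ω :=
  (hS.measurable t).sub (hS.measurable m)

lemma lintegral_abs_sub_rpow (hS : IsGaussianWalk P v S) (t m : ℕ) (r : ℝ) :
    ∫⁻ ω, ENNReal.ofReal (|S t ω - S m ω| ^ r) ∂P =
      ENNReal.ofReal (((v : ℝ) * |(t : ℝ) - m|) ^ (r / 2)) * gaussianAbsMoment r := by
  have key : ∀ m k : ℕ, ∫⁻ ω, ENNReal.ofReal (|S (m + k) ω - S m ω| ^ r) ∂P =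
      ENNReal.ofReal (((v : ℝ) * k) ^ (r / 2)) * gaussianAbsMoment r := by
    intro m k
    rw [lintegral_abs_rpow_of_map_eq (hS.measurable_sub _ _) (hS.map_increment m k)]
    simp
  rcases le_total m t with h | h
  · obtain ⟨k, rfl⟩ := Nat.exists_eq_add_of_le h
    rw [key]
    simp
  · obtain ⟨k, rfl⟩ := Nat.exists_eq_add_of_le h
    simp_rw [abs_sub_comm (S t _)]
    rw [key]
    simp

lemma lintegral_abs_rpow (hS : IsGaussianWalk P v S) (t : ℕ) (r : ℝ) :
    ∫⁻ ω, ENNReal.ofReal (|S t ω| ^ r) ∂P =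
      ENNReal.ofReal (((v : ℝ) * t) ^ (r / 2)) * gaussianAbsMoment r := by
  simpa [hS.zero] using hS.lintegral_abs_sub_rpow t 0 r

end IsGaussianWalk

/-- The sum over all times `t` of `|S_t - S_m| ^ r / (|t - m| + 1) ^ (a r)`. Its `r`-th root is a
random constant `c` such that `|S_t - S_m| ≤ c (|t - m| + 1) ^ a` for all `t`. -/
noncomputable def envelope {Ω : Type*} (S : ℕ → Ω → ℝ) (a r : ℝ) (m : ℕ) (ω : Ω) : ℝ≥0∞ :=
  ∑' t : ℕ, ENNReal.ofReal (|S t ω - S m ω| ^ r / (|(t : ℝ) - m| + 1) ^ (a * r))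

lemma abs_sub_le_of_envelope_lt_top {Ω : Type*} {S : ℕ → Ω → ℝ} {a r : ℝ} (hr : 0 < r) {m : ℕ}
    {ω : Ω} (h : envelope S a r m ω < ∞) (t : ℕ) :
    |S t ω - S m ω| ≤ (envelope S a r m ω).toReal ^ (1 / r) * (|(t : ℝ) - m| + 1) ^ a := by
  set x : ℝ := |(t : ℝ) - m| + 1
  have hx : 0 < x := by positivity
  have h1 : ENNReal.ofReal (|S t ω - S m ω| ^ r / x ^ (a * r)) ≤ envelope S a r m ω :=
    ENNReal.le_tsum (f := fun t : ℕ =>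
      ENNReal.ofReal (|S t ω - S m ω| ^ r / (|(t : ℝ) - m| + 1) ^ (a * r))) t
  have h2 := (ENNReal.ofReal_le_iff_le_toReal h.ne).1 h1
  rw [div_le_iff₀ (by positivity)] at h2
  have h3 := Real.rpow_le_rpow (by positivity) h2 (z := 1 / r) (by positivity)
  rwa [Real.mul_rpow ENNReal.toReal_nonneg (by positivity), ← Real.rpow_mul (abs_nonneg _),
    mul_one_div_cancel hr.ne', Real.rpow_one, ← Real.rpow_mul hx.le,
    mul_assoc, mul_one_div_cancel hr.ne', mul_one] at h3

lemma summable_int_one_div_sq : Summable fun k : ℤ => 1 / (|(k : ℝ)| + 1) ^ 2 := by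
  have h : Summable fun n : ℕ => 1 / ((n : ℝ) + 1) ^ 2 := by
    have := (summable_nat_add_iff 1).2 (Real.summable_one_div_nat_pow.2 (one_lt_two))
    simpa using this
  refine Summable.of_nat_of_neg ?_ ?_ <;> simpa using h

lemma measurable_envelope {Ω : Type*} [MeasurableSpace Ω] {S : ℕ → Ω → ℝ}
    (hS : ∀ t, Measurable (S t)) (a r : ℝ) (m : ℕ) : Measurable (envelope S a r m) := by
  unfold envelope
  exact Measurable.tsum fun t =>
    by have := hS t; have := hS m; fun_prop

/-- The moments of the envelope are bounded uniformly in the base point `m`; this is where the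
exponent `a > 1 / 2` is needed. -/
lemma IsGaussianWalk.exists_lintegral_envelope_le {Ω : Type*} [MeasurableSpace Ω] {P : Measure Ω}
    {v : NNReal} {S : ℕ → Ω → ℝ} (hS : IsGaussianWalk P v S) {a r : ℝ} (hr : 0 < r)
    (har : 2 ≤ (a - 1 / 2) * r) :
    ∃ C : ℝ≥0∞, C < ∞ ∧ ∀ m, ∫⁻ ω, envelope S a r m ω ∂P ≤ C := by
  set M := ENNReal.ofReal ((v : ℝ) ^ (r / 2)) * gaussianAbsMoment r with hM
  refine ⟨M * ∑' k : ℤ, ENNReal.ofReal (1 / (|(k : ℝ)| + 1) ^ 2), ?_, fun m => ?_⟩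
  · refine ENNReal.mul_lt_top (ENNReal.mul_lt_top ENNReal.ofReal_lt_top
      (gaussianAbsMoment_lt_top hr)) ?_
    rw [← ENNReal.ofReal_tsum_of_nonneg (fun _ => by positivity) summable_int_one_div_sq]
    exact ENNReal.ofReal_lt_top
  · unfold envelope
    rw [lintegral_tsum fun t => ((((hS.measurable_sub t m).abs.pow_const
      r).div_const _).ennreal_ofReal).aemeasurable, ← ENNReal.tsum_mul_left]
    have hinj : Function.Injective fun t : ℕ => (t : ℤ) - m := fun x y h => by
      simpa using h
    refine le_trans ?_ (ENNReal.tsum_comp_le_tsum_of_injective hinj _)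
    refine ENNReal.tsum_le_tsum fun t => ?_
    set x : ℝ := |(t : ℝ) - m| with hx
    have hx0 : 0 ≤ x := abs_nonneg _
    have e1 : ∀ ω, ENNReal.ofReal (|S t ω - S m ω| ^ r / (x + 1) ^ (a * r)) =
        ENNReal.ofReal (1 / (x + 1) ^ (a * r)) * ENNReal.ofReal (|S t ω - S m ω| ^ r) := by
      intro ω
      rw [← ENNReal.ofReal_mul (by positivity)]
      congr 1
      ring
    simp_rw [e1]
    rw [lintegral_const_mul _ ((hS.measurable_sub t m).abs.pow_const
      r).ennreal_ofReal, hS.lintegral_abs_sub_rpow, ← mul_assoc,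
      ← ENNReal.ofReal_mul (by positivity), ← hx, Real.mul_rpow (by positivity) hx0]
    have e2 : |(((t : ℤ) - m : ℤ) : ℝ)| = x := by push_cast; rfl
    simp only [e2]
    rw [hM, mul_right_comm (ENNReal.ofReal _), ← ENNReal.ofReal_mul (by positivity)]
    gcongr ENNReal.ofReal ?_ * _
    have h1 : x ^ (r / 2) / (x + 1) ^ (a * r) ≤ 1 / (x + 1) ^ 2 := by
      rw [div_le_div_iff₀ (by positivity) (by positivity), one_mul]
      calc x ^ (r / 2) * (x + 1) ^ 2 ≤ (x + 1) ^ (r / 2) * (x + 1) ^ (2 : ℝ) := by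
            rw [Real.rpow_two]
            gcongr
            linarith
        _ = (x + 1) ^ (r / 2 + 2) := by rw [← Real.rpow_add (by positivity)]
        _ ≤ (x + 1) ^ (a * r) := Real.rpow_le_rpow_of_exponent_le (by linarith) (by linarith)
    calc 1 / (x + 1) ^ (a * r) * ((v : ℝ) ^ (r / 2) * x ^ (r / 2))
        = (v : ℝ) ^ (r / 2) * (x ^ (r / 2) / (x + 1) ^ (a * r)) := by ring
      _ ≤ _ := by gcongr

/-! ### First passage times of Gaussian walks in `L^p` -/

lemma add_add_rpow_le {x y z p : ℝ} (hx : 0 ≤ x) (hy : 0 ≤ y) (hz : 0 ≤ z) (hp : 0 ≤ p) :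
    (x + y + z) ^ p ≤ 3 ^ p * (x ^ p + y ^ p + z ^ p) := by
  set M := max x (max y z) with hM
  have hxM : x ≤ M := le_max_left _ _
  have hyM : y ≤ M := (le_max_left _ _).trans (le_max_right _ _)
  have hzM : z ≤ M := (le_max_right _ _).trans (le_max_right _ _)
  have h1 : (x + y + z) ^ p ≤ (3 * M) ^ p :=
    Real.rpow_le_rpow (by positivity) (by linarith) hp
  rw [Real.mul_rpow (by norm_num) (hx.trans hxM)] at h1
  refine h1.trans ?_
  gcongr
  have px : 0 ≤ x ^ p := by positivity
  have py : 0 ≤ y ^ p := by positivity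
  have pz : 0 ≤ z ^ p := by positivity
  rcases max_choice x (max y z) with h | h
  · rw [hM, h]; linarith
  · rcases max_choice y z with h' | h'
    · rw [hM, h, h']; linarith
    · rw [hM, h, h']; linarith

lemma singleTime_bounds {s q l : ℝ} (hs : 0 < s) (hq : q < 1) (hl : s ≤ l) :
    (singleTime s q l : ℝ) ≤ l / s - (l / s) ^ q ∧
      l / s - (l / s) ^ q < singleTime s q l + 1 := by
  have hu : 1 ≤ l / s := by rwa [one_le_div hs]
  have h : (l / s) ^ q ≤ l / s := by
    simpa using Real.rpow_le_rpow_of_exponent_le hu hq.le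
  exact ⟨Nat.floor_le (by linarith), Nat.lt_floor_add_one _⟩

lemma tendsto_rpow_div_sqrt {s a : ℝ} (hs : 0 < s) (ha : a < 1 / 2) :
    Tendsto (fun l : ℝ => (l / s) ^ a / √l) atTop (𝓝 0) := by
  have h := (tendsto_rpow_neg_atTop (y := 1 / 2 - a) (by linarith)).const_mul (s ^ a)⁻¹
  rw [mul_zero] at h
  refine h.congr' ?_
  filter_upwards [eventually_gt_atTop 0] with l hl
  rw [Real.div_rpow hl.le hs.le, Real.sqrt_eq_rpow, neg_sub, Real.rpow_sub hl]
  field_simp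

/-- A bound of order `l ^ a` with `a < 1 / 2` is negligible on the scale `√l`. -/
lemma tendsto_div_sqrt_of_le {f : ℝ → ℝ≥0∞} {s a K : ℝ} {C : ℝ≥0∞} (hs : 0 < s) (ha : a < 1 / 2)
    (hC : C < ∞) (h : ∀ᶠ l in atTop, f l ≤ ENNReal.ofReal (K * (l / s) ^ a) * C) :
    Tendsto (fun l => f l / ENNReal.ofReal √l) atTop (𝓝 0) := by
  have h1 : Tendsto (fun l : ℝ => ENNReal.ofReal (K * ((l / s) ^ a / √l)) * C) atTop (𝓝 0) := by
    have h2 := (tendsto_rpow_div_sqrt hs ha).const_mul K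
    rw [mul_zero] at h2
    have h3 := ENNReal.Tendsto.mul_const (b := C) (ENNReal.tendsto_ofReal h2) (Or.inr hC.ne)
    simpa using h3
  refine tendsto_of_tendsto_of_tendsto_of_le_of_le' tendsto_const_nhds h1
    (Eventually.of_forall fun _ => zero_le) ?_
  filter_upwards [h, eventually_gt_atTop 0] with l hl hl0
  have hsq : 0 < √l := Real.sqrt_pos.2 hl0
  rw [← mul_div_assoc, ENNReal.ofReal_div_of_pos hsq, ENNReal.div_eq_inv_mul,
    ENNReal.div_eq_inv_mul, mul_assoc]
  gcongr

namespace IsGaussianWalk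

variable {Ω : Type*} [MeasurableSpace Ω] {P : Measure Ω} {v : NNReal} {S : ℕ → Ω → ℝ}

lemma ae_envelope_lt_top (hS : IsGaussianWalk P v S) {a r : ℝ} (hr : 0 < r)
    (har : 2 ≤ (a - 1 / 2) * r) (m : ℕ) :
    ∀ᵐ ω ∂P, envelope S a r m ω < ∞ := by
  obtain ⟨C, hC, h⟩ := hS.exists_lintegral_envelope_le hr har
  exact ae_lt_top (measurable_envelope hS.measurable a r m) ((h m).trans_lt hC).ne

lemma ae_exists_level_le (hS : IsGaussianWalk P v S) {s : ℝ} (hs : 0 < s) (l : ℝ) :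
    ∀ᵐ ω ∂P, ∃ t : ℕ, l ≤ S t ω + s * t := by
  filter_upwards [hS.ae_envelope_lt_top (a := 3 / 4) (r := 8) (by norm_num) (by norm_num) 0]
    with ω hω
  exact exists_level_le_of_envelope hs (by norm_num)
    (abs_sub_le_of_envelope_lt_top (by norm_num) hω)

lemma ae_firstPassage_ne_top (hS : IsGaussianWalk P v S) {s : ℝ} (hs : 0 < s) (l : ℝ) :
    ∀ᵐ ω ∂P, firstPassage (fun t ω => S t ω + s * t) l ω ≠ ⊤ := by
  filter_upwards [hS.ae_exists_level_le hs l] with ω hω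
  obtain ⟨n, hn, -⟩ := firstPassage_eq_coe (fun t ω => S t ω + s * t) l ω hω
  rw [hn]
  exact WithTop.coe_ne_top

/-- The moments of `|S_m| / (l/s)^q` stay bounded because `m ≤ l / s ≤ (l / s) ^ (2 q)`. -/
lemma lintegral_normalized_rpow_le (hS : IsGaussianWalk P v S) {s q l r : ℝ} (hs : 0 < s)
    (hq : q ∈ Set.Ioo (1 / 2 : ℝ) 1) (hl : s ≤ l) (hr : 0 ≤ r) :
    ∫⁻ ω, ENNReal.ofReal ((|S (singleTime s q l) ω| / (l / s) ^ q) ^ r) ∂P ≤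
      ENNReal.ofReal ((v : ℝ) ^ (r / 2)) * gaussianAbsMoment r := by
  have hu : 1 ≤ l / s := by rwa [one_le_div hs]
  set u := l / s with hu'
  set m := singleTime s q l
  have hm : (m : ℝ) ≤ u := by
    have := (singleTime_bounds hs hq.2 hl).1
    have h2 : 0 ≤ u ^ q := by positivity
    linarith
  have e : ∀ ω, ENNReal.ofReal ((|S m ω| / u ^ q) ^ r) =
      ENNReal.ofReal (1 / u ^ (q * r)) * ENNReal.ofReal (|S m ω| ^ r) := by
    intro ω
    rw [← ENNReal.ofReal_mul (by positivity), Real.div_rpow (by positivity) (by positivity),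
      ← Real.rpow_mul (by positivity)]
    congr 1
    ring
  simp_rw [e]
  rw [lintegral_const_mul _ ((hS.measurable m).abs.pow_const r).ennreal_ofReal,
    hS.lintegral_abs_rpow, ← mul_assoc, ← ENNReal.ofReal_mul (by positivity)]
  gcongr
  rw [Real.mul_rpow (by positivity) (by positivity), one_div_mul_eq_div,
    div_le_iff₀ (by positivity)]
  gcongr
  calc (m : ℝ) ^ (r / 2) ≤ u ^ (r / 2) := by gcongr
    _ ≤ u ^ (q * r) := Real.rpow_le_rpow_of_exponent_le hu (by nlinarith [hq.1])

/-- Up to an error that is `o(√l)` in `L^p`, the first passage time over `l` is determined by the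
position of the walk at the time `m = singleTime s q l`: the walk needs `(l - Z_m) / s` more steps,
as if it moved deterministically. -/
lemma tendsto_eLpNorm_firstPassage_sub (hS : IsGaussianWalk P v S) [IsProbabilityMeasure P]
    {s p q : ℝ} (hs : 0 < s) (hp : 1 ≤ p) (hq : q ∈ Set.Ioo (1 / 2 : ℝ) 1) :
    Tendsto (fun l => eLpNorm' (fun ω =>
      (timeToEReal (firstPassage (fun t ω => S t ω + s * t) l ω)).toReal -
        (singleTime s q l +
          (l - (S (singleTime s q l) ω + s * singleTime s q l)) / s)) p P / ENNReal.ofReal √l)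
      atTop (𝓝 0) := by
  have hq0 : 0 < q := by linarith [hq.1]
  -- `a > 1 / 2` makes the envelope finite and `q a < 1 / 2` makes the error `o(√l)`.
  obtain ⟨a, ha0, ha1⟩ : ∃ a, 1 / 2 < a ∧ a < 1 / (2 * q) := by
    apply exists_between
    rw [div_lt_div_iff₀ (by norm_num) (by positivity)]
    linarith [hq.2]
  have hqa : q * a < 1 / 2 := by
    rw [lt_div_iff₀ (by positivity)] at ha1
    linarith
  have ha1' : a < 1 := ha1.trans_le (by rw [div_le_one (by positivity)]; linarith [hq.1])
  set k := 1 / (1 - a) with hk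
  have hk0 : 0 < k := by apply one_div_pos.2; linarith
  -- The error contains the power `1 / (1 - a)` of the `r`-th root of the envelope.
  set r := max (k * p) (2 / (a - 1 / 2)) with hr
  have hrk : k * p ≤ r := le_max_left _ _
  have hr0 : 0 < r := lt_of_lt_of_le (by positivity) hrk
  have har : 2 ≤ (a - 1 / 2) * r := by
    have : 2 / (a - 1 / 2) ≤ r := le_max_right _ _
    rwa [div_le_iff₀' (by linarith)] at this
  obtain ⟨C, hC, hCle⟩ := hS.exists_lintegral_envelope_le hr0 har
  set D := ENNReal.ofReal ((v : ℝ) ^ (2 * p / 2)) * gaussianAbsMoment (2 * p) with hD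
  have hDtop : D < ∞ := ENNReal.mul_lt_top ENNReal.ofReal_lt_top
    (gaussianAbsMoment_lt_top (by positivity))
  set K := 2 * 4 ^ k + 2 * (4 / s) ^ k + 128 + 8 / s ^ 2 with hK
  have hK0 : 0 < K := by positivity
  refine tendsto_div_sqrt_of_le (K := 3 * K) (C := (2 + C + D) ^ (1 / p)) hs hqa
    (ENNReal.rpow_lt_top_of_nonneg (by positivity) (by
      simp [hC.ne, hDtop.ne])) ?_
  filter_upwards [eventually_ge_atTop s] with l hl
  have hl0 : 0 < l := hs.trans_le hl
  have hu : 1 ≤ l / s := by rwa [one_le_div hs]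
  set u := l / s with hu'
  set m := singleTime s q l with hm
  set w := u ^ (q * a) with hw
  have hw0 : 0 < w := by positivity
  have hmb := singleTime_bounds hs hq.2 hl
  have hmu : |u - m| ≤ u ^ q + 1 := by
    have h2 : 0 ≤ u ^ q := by positivity
    rw [abs_le]
    constructor <;> linarith [hmb.1, hmb.2]
  set e : Ω → ℝ := fun ω => (timeToEReal (firstPassage (fun t ω => S t ω + s * t) l ω)).toReal -
        (m + (l - (S m ω + s * m)) / s) with he
  have hpt : ∀ᵐ ω ∂P, ‖e ω‖ₑ ^ p ≤ ENNReal.ofReal ((3 * K * w) ^ p) *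
      (2 + envelope S a r m ω + ENNReal.ofReal ((|S m ω| / u ^ q) ^ (2 * p))) := by
    filter_upwards [hS.ae_envelope_lt_top hr0 har m] with ω hω
    set c := (envelope S a r m ω).toReal ^ (1 / r) with hc
    have hc0 : 0 ≤ c := by positivity
    have hB := abs_sub_le_of_envelope_lt_top hr0 hω
    obtain ⟨n, hn, hn1, hn2⟩ := firstPassage_eq_coe (fun t ω => S t ω + s * t) l ω
      (exists_level_le_of_envelope hs ha1' hB)
    have hn0 : n ≠ 0 := by
      rintro rfl
      simp [hS.zero] at hn1
      linarith
    have hbd := firstPassage_error_le_moments (S := fun t => S t ω) hs ha0 ha1' hc0 hq0 hl hmu hB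
      hn0 hn1 hn2
    have heq : e ω = (n : ℝ) - (m + (l - (S m ω + s * m)) / s) := by
      simp only [he, hn]
      rfl
    rw [enorm_rpow_eq_ofReal _ (by linarith), heq]
    set g := (envelope S a r m ω).toReal with hg
    have hg0 : 0 ≤ g := ENNReal.toReal_nonneg
    have hcg : (c ^ k) ^ p ≤ 1 + g := by
      rw [← Real.rpow_mul hc0]
      have hcr : c ^ r = g := by
        rw [hc, ← Real.rpow_mul hg0, one_div_mul_cancel hr0.ne', Real.rpow_one]
      rcases le_total c 1 with h | h
      · have := Real.rpow_le_one hc0 h (z := k * p) (by positivity)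
        linarith
      · have := Real.rpow_le_rpow_of_exponent_le h hrk
        linarith
    set N := |S m ω| / u ^ q with hN
    have hN0 : 0 ≤ N := by positivity
    have hfin : |(n : ℝ) - (m + (l - (S m ω + s * m)) / s)| ^ p ≤
        (3 * K * w) ^ p * (2 + g + N ^ (2 * p)) := by
      refine (Real.rpow_le_rpow (abs_nonneg _) hbd (by linarith)).trans ?_
      change (K * w * (1 + c ^ k + N ^ 2)) ^ p ≤ _
      rw [Real.mul_rpow (by positivity) (by positivity)]
      have e3 : (3 * K * w) ^ p = (K * w) ^ p * 3 ^ p := by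
        rw [← Real.mul_rpow (by positivity) (by norm_num)]; congr 1; ring
      rw [e3, mul_assoc]
      refine mul_le_mul_of_nonneg_left ?_ (by positivity)
      refine (add_add_rpow_le zero_le_one (by positivity) (by positivity) (by linarith)).trans ?_
      refine mul_le_mul_of_nonneg_left ?_ (by positivity)
      rw [Real.one_rpow, Real.rpow_mul hN0, Real.rpow_two]
      linarith
    refine (ENNReal.ofReal_le_ofReal hfin).trans_eq ?_
    rw [ENNReal.ofReal_mul (by positivity), ENNReal.ofReal_add (by positivity) (by positivity),
      ENNReal.ofReal_add (by norm_num) hg0, hg, ENNReal.ofReal_toReal hω.ne]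
    simp
  have hint : ∫⁻ ω, ‖e ω‖ₑ ^ p ∂P ≤ ENNReal.ofReal ((3 * K * w) ^ p) * (2 + C + D) := by
    have hme := measurable_envelope hS.measurable a r m
    refine (lintegral_mono_ae hpt).trans ?_
    rw [lintegral_const_mul' _ _ ENNReal.ofReal_ne_top, lintegral_add_left (by fun_prop),
      lintegral_add_left (by fun_prop)]
    gcongr
    · simp
    · exact hCle m
    · exact hS.lintegral_normalized_rpow_le hs hq hl (by positivity)
  rw [eLpNorm'_eq_lintegral_enorm]
  refine (ENNReal.rpow_le_rpow hint (by positivity)).trans_eq ?_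
  rw [ENNReal.mul_rpow_of_nonneg _ _ (by positivity),
    ENNReal.ofReal_rpow_of_nonneg (by positivity) (by positivity), ← Real.rpow_mul (by positivity),
    mul_one_div_cancel (by linarith), Real.rpow_one]

end IsGaussianWalk

/-! ### Sums, independence and symmetry -/

section Independence

variable {Ω : Type*} [MeasurableSpace Ω] {P : Measure Ω}

lemma isGaussianWalk_sum [IsProbabilityMeasure P] {V : ℕ → Ω → ℝ} (hVm : ∀ i, Measurable (V i))
    (hV : ∀ i, P.map (V i) = gaussianReal 0 1) (hVi : iIndepFun V P) :
    IsGaussianWalk P 1 (fun t ω => ∑ i ∈ Finset.range t, V i ω) where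
  measurable t := by fun_prop
  zero ω := by simp
  map_increment m k := by
    have e : (fun ω => ∑ i ∈ Finset.range (m + k), V i ω - ∑ i ∈ Finset.range m, V i ω) =
        ∑ i ∈ Finset.range k, V (m + i) := by
      ext ω
      rw [Finset.sum_range_add, add_sub_cancel_left, Finset.sum_apply]
    rw [e]
    have hi : iIndepFun (fun i => V (m + i)) P :=
      hVi.precomp (g := fun i => m + i) (fun x y h => by simpa using h)
    induction k with
    | zero =>
      have : (0 : Ω → ℝ) = fun _ => (0 : ℝ) := rfl
      simp [this]
    | succ k ih =>
      rw [Finset.sum_range_succ]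
      have hind := hi.indepFun_sum_range_succ (fun i => hVm (m + i)) k
      have := gaussianReal_add_gaussianReal_of_indepFun hind
        (ih (by ext ω; rw [Finset.sum_range_add, add_sub_cancel_left, Finset.sum_apply]))
        (hV (m + k))
      rw [this]
      simp

lemma IsGaussianWalk.linear_combination {S T : ℕ → Ω → ℝ} {v w u : NNReal}
    (hS : IsGaussianWalk P v S) (hT : IsGaussianWalk P w T)
    (h : IndepFun (fun ω i => S i ω) (fun ω i => T i ω) P) (a b : ℝ)
    (hu : (u : ℝ) = a ^ 2 * v + b ^ 2 * w) :
    IsGaussianWalk P u (fun t ω => a * S t ω + b * T t ω) where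
  measurable t := by
    have := hS.measurable t
    have := hT.measurable t
    fun_prop
  zero ω := by simp [hS.zero, hT.zero]
  map_increment m k := by
    have key : ∀ {S : ℕ → Ω → ℝ} {v : NNReal} (_ : IsGaussianWalk P v S) (a : ℝ),
        P.map (fun ω => a * (S (m + k) ω - S m ω)) =
          gaussianReal 0 (NNReal.mk (a ^ 2) (sq_nonneg _) * (v * k)) := by
      intro S v hS a
      have h1 := gaussianReal_map_const_mul (μ := 0) (v := v * k) a
      rw [← hS.map_increment m k, Measure.map_map (by fun_prop) (hS.measurable_sub _ _)] at h1
      simpa [Function.comp_def] using h1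
    have hind : IndepFun (fun ω => a * (S (m + k) ω - S m ω))
        (fun ω => b * (T (m + k) ω - T m ω)) P :=
      h.comp (φ := fun x : ℕ → ℝ => a * (x (m + k) - x m))
        (ψ := fun x : ℕ → ℝ => b * (x (m + k) - x m)) (by fun_prop) (by fun_prop)
    have := gaussianReal_add_gaussianReal_of_indepFun hind (key hS a) (key hT b)
    have e : (fun ω => a * S (m + k) ω + b * T (m + k) ω - (a * S m ω + b * T m ω)) =
        (fun ω => a * (S (m + k) ω - S m ω)) + fun ω => b * (T (m + k) ω - T m ω) := by
      ext ω
      simp only [Pi.add_apply]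
      ring
    rw [e, this]
    congr 1
    · simp
    · ext
      push_cast
      rw [hu]
      ring

lemma isGaussianProcess_sumElim {V W : ℕ → Ω → ℝ}
    (hV : ∀ i, HasGaussianLaw (V i) P) (hW : ∀ i, HasGaussianLaw (W i) P)
    (hVi : iIndepFun V P) (hWi : iIndepFun W P)
    (hVW : IndepFun (fun ω i => V i ω) (fun ω i => W i ω) P) :
    IsGaussianProcess (Sum.elim V W) P where
  hasGaussianLaw I := by
    have hA : HasGaussianLaw (fun ω (i : I.toLeft) => V i ω) P :=
      iIndepFun.hasGaussianLaw (fun i => hV i) (hVi.precomp Subtype.val_injective)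
    have hB : HasGaussianLaw (fun ω (i : I.toRight) => W i ω) P :=
      iIndepFun.hasGaussianLaw (fun i => hW i) (hWi.precomp Subtype.val_injective)
    have hAB : HasGaussianLaw
        (fun ω => ((fun i : I.toLeft => V i ω), fun i : I.toRight => W i ω)) P :=
      IndepFun.hasGaussianLaw hA hB
        (hVW.comp (φ := fun (x : ℕ → ℝ) (i : I.toLeft) => x i)
          (ψ := fun (x : ℕ → ℝ) (i : I.toRight) => x i) (by fun_prop) (by fun_prop))
    let L : ((I.toLeft → ℝ) × (I.toRight → ℝ)) →ₗ[ℝ] (I → ℝ) :=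
      { toFun x i := match i with
          | ⟨.inl a, h⟩ => x.1 ⟨a, Finset.mem_toLeft.2 h⟩
          | ⟨.inr b, h⟩ => x.2 ⟨b, Finset.mem_toRight.2 h⟩
        map_add' x y := by ext ⟨i | i, h⟩ <;> rfl
        map_smul' c x := by ext ⟨i | i, h⟩ <;> rfl }
    have h := hAB.map (LinearMap.toContinuousLinearMap L)
    refine h.congr (ae_of_all _ fun ω => ?_)
    ext ⟨i | i, h⟩ <;> rfl

/-- The increments `V_i + ε W_i` of the observations are uncorrelated with, hence independent of,
the variables `ε V_i - W_i`. -/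
lemma indepFun_rotated [IsProbabilityMeasure P] {V W : ℕ → Ω → ℝ}
    (hVm : ∀ i, Measurable (V i)) (hWm : ∀ i, Measurable (W i))
    (hV : ∀ i, P.map (V i) = gaussianReal 0 1) (hW : ∀ i, P.map (W i) = gaussianReal 0 1)
    (hVi : iIndepFun V P) (hWi : iIndepFun W P)
    (hVW : IndepFun (fun ω i => V i ω) (fun ω i => W i ω) P) (ε : ℝ) :
    IndepFun (fun ω i => V i ω + ε * W i ω) (fun ω i => ε * V i ω - W i ω) P := by
  have hVg : ∀ i, HasGaussianLaw (V i) P := fun i => ⟨by rw [hV]; infer_instance⟩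
  have hWg : ∀ i, HasGaussianLaw (W i) P := fun i => ⟨by rw [hW]; infer_instance⟩
  have hVL := fun i => (hVg i).memLp_two
  have hWL := fun i => (hWg i).memLp_two
  have hcov : ∀ {V : ℕ → Ω → ℝ}, (∀ i, Measurable (V i)) → (∀ i, P.map (V i) = gaussianReal 0 1) →
      (∀ i, MemLp (V i) 2 P) → iIndepFun V P →
      ∀ i j, cov[V i, V j; P] = if i = j then 1 else 0 := by
    intro V hm hV hL hi i j
    split_ifs with h
    · subst h
      rw [covariance_self (hm i).aemeasurable]
      have := variance_id_gaussianReal (μ := 0) (v := 1)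
      rw [← hV i, variance_map aemeasurable_id (hm i).aemeasurable] at this
      simpa using this
    · exact (hi.indepFun h).covariance_eq_zero (hL i) (hL j)
  have hVWc : ∀ i j, cov[V i, W j; P] = 0 := fun i j =>
    (hVW.comp (φ := fun x : ℕ → ℝ => x i) (ψ := fun x : ℕ → ℝ => x j) (by fun_prop)
      (by fun_prop)).covariance_eq_zero (hVL i) (hWL j)
  have hG : IsGaussianProcess (Sum.elim (fun i => V i + ε • W i) fun i => ε • V i - W i) P := by
    refine IsGaussianProcess.of_isGaussianProcess
      (isGaussianProcess_sumElim hVg hWg hVi hWi hVW) fun i => ?_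
    rcases i with i | i
    · refine ⟨{.inl i, .inr i}, LinearMap.toContinuousLinearMap
        (LinearMap.proj ⟨.inl i, by simp⟩ + ε • LinearMap.proj ⟨.inr i, by simp⟩), fun ω => ?_⟩
      simp
    · refine ⟨{.inl i, .inr i}, LinearMap.toContinuousLinearMap
        (ε • LinearMap.proj ⟨.inl i, by simp⟩ - LinearMap.proj ⟨.inr i, by simp⟩), fun ω => ?_⟩
      simp
  refine hG.indepFun_of_covariance_eq_zero (fun i => by fun_prop) (fun i => by fun_prop)
    fun i j => ?_
  have h1 : MemLp (ε • V j - W j) 2 P := ((hVL j).const_smul ε).sub (hWL j)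
  rw [covariance_add_left (hVL i) ((hWL i).const_smul ε) h1,
    covariance_sub_right (hVL i) ((hVL j).const_smul ε) (hWL j),
    covariance_sub_right ((hWL i).const_smul ε) ((hVL j).const_smul ε) (hWL j)]
  simp only [covariance_smul_left, covariance_smul_right, hcov hVm hV hVL hVi,
    hcov hWm hW hWL hWi, hVWc, covariance_comm (W i) (V j)]
  ring

/-- A symmetric variable that is independent of the data cannot be estimated better than by `0`:
`h(Y) - R` and `h(Y) + R` have the same law and differ by `2 R`. -/
lemma eLpNorm_le_eLpNorm_sub_of_indepFun [IsProbabilityMeasure P] {E : Type*} [MeasurableSpace E]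
    {Y : Ω → E} {R : Ω → ℝ} (hY : Measurable Y) (hR : Measurable R) (hYR : IndepFun Y R P)
    (hsymm : P.map (fun ω => -R ω) = P.map R) {h : E → ℝ} (hh : Measurable h) {p : ℝ}
    (hp : 1 ≤ p) :
    eLpNorm' R p P ≤ eLpNorm' (fun ω => h (Y ω) - R ω) p P := by
  have hRn : Measurable fun ω => -R ω := hR.neg
  have hYR' : IndepFun Y (fun ω => -R ω) P := hYR.comp measurable_id measurable_neg
  have hlaw : P.map (fun ω => (Y ω, -R ω)) = P.map (fun ω => (Y ω, R ω)) := by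
    rw [(indepFun_iff_map_prod_eq_prod_map_map hY.aemeasurable hR.aemeasurable).1 hYR,
      (indepFun_iff_map_prod_eq_prod_map_map hY.aemeasurable hRn.aemeasurable).1 hYR', hsymm]
  have e : eLpNorm' (fun ω => h (Y ω) + R ω) p P = eLpNorm' (fun ω => h (Y ω) - R ω) p P := by
    have hF : Measurable fun z : E × ℝ => ‖h z.1 - z.2‖ₑ ^ p := by fun_prop
    rw [eLpNorm'_eq_lintegral_enorm, eLpNorm'_eq_lintegral_enorm]
    congr 1
    have h1 := lintegral_map (μ := P) hF (hY.prodMk hR)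
    have h2 := lintegral_map (μ := P) hF (hY.prodMk hR.neg)
    change ∫⁻ z, _ ∂(P.map fun ω => (Y ω, -R ω)) = _ at h2
    rw [hlaw, h1] at h2
    simpa using h2.symm
  have hm1 : AEStronglyMeasurable (fun ω => h (Y ω) + R ω) P :=
    ((hh.comp hY).add hR).aestronglyMeasurable
  have hm2 : AEStronglyMeasurable (fun ω => -(h (Y ω) - R ω)) P :=
    ((hh.comp hY).sub hR).neg.aestronglyMeasurable
  have h2 := eLpNorm'_add_le hm1 hm2 hp
  have e2 : ((fun ω => h (Y ω) + R ω) + fun ω => -(h (Y ω) - R ω)) = (2 : ℝ) • R := by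
    ext ω
    simp only [Pi.add_apply, Pi.smul_apply, smul_eq_mul]
    ring
  have e3 : eLpNorm' (fun ω => -(h (Y ω) - R ω)) p P = eLpNorm' (fun ω => h (Y ω) - R ω) p P :=
    eLpNorm'_neg (fun ω => h (Y ω) - R ω) p P
  rw [e2, eLpNorm'_const_smul _ (by linarith), e, e3, ← two_mul] at h2
  have e4 : ‖(2 : ℝ)‖ₑ = 2 := by
    rw [Real.enorm_eq_ofReal_abs]; simp
  rw [e4] at h2
  exact (ENNReal.mul_le_mul_iff_right (by simp) (by simp)).1 h2

end Independence

/-! ### Measurability, stopping times and the single-observation rule -/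

section Measurability

variable {Ω : Type*} [MeasurableSpace Ω] {P : Measure Ω}

lemma timeToEReal_coe (n : ℕ) : timeToEReal (n : WithTop ℕ) = ((n : ℝ) : EReal) := rfl

lemma measurable_timeToEReal_firstPassage {Z : ℕ → Ω → ℝ} (hZ : ∀ t, Measurable (Z t)) (l : ℝ) :
    Measurable fun ω => timeToEReal (firstPassage Z l ω) := by
  have e : (fun ω => timeToEReal (firstPassage Z l ω)) =
      fun ω => ⨅ t : ℕ, if l ≤ Z t ω then ((t : ℝ) : EReal) else ⊤ := by
    ext ω
    by_cases h : ∃ t, l ≤ Z t ω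
    · obtain ⟨n, hn, hn1, hn2⟩ := firstPassage_eq_coe Z l ω h
      rw [hn, timeToEReal_coe]
      apply le_antisymm
      · refine le_iInf fun t => ?_
        split_ifs with ht
        · have : n ≤ t := not_lt.1 fun h' => absurd (hn2 t h') (not_lt.2 ht)
          exact_mod_cast this
        · exact le_top
      · exact (iInf_le _ n).trans_eq (if_pos hn1)
    · push Not at h
      have h1 : firstPassage Z l ω = ⊤ :=
        hittingAfter_eq_top_iff.2 fun j _ => by simpa using h j
      rw [h1]
      refine (iInf_eq_top.2 fun t => if_neg (not_le.2 (h t))).symm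
  rw [e]
  exact Measurable.iInf fun t =>
    Measurable.ite (measurableSet_le measurable_const (hZ t)) measurable_const measurable_const

lemma measurable_timeToEReal_singleRule {s ε q l : ℝ} {Y : ℕ → Ω → ℝ} (hY : ∀ t, Measurable (Y t)) :
    Measurable fun ω => timeToEReal (singleRule s ε q Y l ω) := by
  have : Measurable fun ω => ⌊max 0 (l - mmse s ε (singleTime s q l)
      (Y (singleTime s q l) ω)) / s⌋₊ := by
    refine Nat.measurable_floor.comp ?_
    have := hY (singleTime s q l)
    unfold mmse
    fun_prop
  simp only [singleRule, timeToEReal_coe]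
  exact measurable_coe_real_ereal.comp
    ((measurable_from_top (f := fun n : ℕ => (n : ℝ))).comp (measurable_const.add this))

lemma isStoppingTime_seqRule {V W : ℕ → Ω → ℝ} (hVm : ∀ i, Measurable (V i))
    (hWm : ∀ i, Measurable (W i)) (s ε l : ℝ) :
    IsStoppingTime (obsFiltration s ε hVm hWm) (seqRule s ε (obs s ε V W) l) := by
  unfold seqRule firstPassage
  refine Adapted.isStoppingTime_hittingAfter (fun t => ?_) measurableSet_Ici
  have h : Measurable[obsFiltration s ε hVm hWm t] (obs s ε V W t) :=
    (Filtration.stronglyAdapted_natural (stronglyMeasurable_obs s ε hVm hWm) t).measurable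
  unfold mmse
  exact (h.const_mul _).add_const _

lemma isStoppingTime_singleRule {V W : ℕ → Ω → ℝ} (hVm : ∀ i, Measurable (V i))
    (hWm : ∀ i, Measurable (W i)) (s ε q l : ℝ) :
    IsStoppingTime (obsFiltration s ε hVm hWm) (singleRule s ε q (obs s ε V W) l) := by
  intro i
  set m := singleTime s q l with hm
  have h : Measurable[obsFiltration s ε hVm hWm m] (obs s ε V W m) :=
    (Filtration.stronglyAdapted_natural (stronglyMeasurable_obs s ε hVm hWm) m).measurable
  have h2 : Measurable[obsFiltration s ε hVm hWm m]
      fun ω => m + ⌊max 0 (l - mmse s ε m (obs s ε V W m ω)) / s⌋₊ := by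
    refine Measurable.const_add (Nat.measurable_floor.comp ?_) _
    have hmax : Measurable fun y : ℝ => max 0 (l - mmse s ε m y) / s := by
      unfold mmse
      fun_prop
    exact hmax.comp h
  have e : {ω | singleRule s ε q (obs s ε V W) l ω ≤ WithTop.some i} =
      {ω | m + ⌊max 0 (l - mmse s ε m (obs s ε V W m ω)) / s⌋₊ ≤ i} := by
    ext ω
    simp only [singleRule, Set.mem_ofPred_eq]
    exact WithTop.coe_le_coe
  rw [e]
  by_cases hmi : m ≤ i
  · exact (obsFiltration s ε hVm hWm).mono hmi _ (h2 measurableSet_Iic)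
  · -- Before time `m` the rule never stops.
    convert! MeasurableSet.empty
    ext ω
    simp only [Set.mem_ofPred_eq, Set.mem_empty_iff_false, iff_false]
    omega

end Measurability

section Risk

variable {Ω : Type*} [MeasurableSpace Ω] {P : Measure Ω}

lemma enorm_toReal_sub_toReal_le (a b : EReal) : ‖a.toReal - b.toReal‖ₑ ≤ (a - b).abs := by
  induction a <;> induction b <;>
    simp [Real.enorm_eq_ofReal_abs, ← EReal.coe_sub, EReal.abs_def]

lemma rpow_eLpNorm_le_absMoment {p : ℝ} (hp : 0 < p) (A B : Ω → EReal) :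
    eLpNorm' (fun ω => (A ω).toReal - (B ω).toReal) p P ^ p ≤ absMoment P p A B := by
  rw [← lintegral_rpow_enorm_eq_rpow_eLpNorm' hp]
  exact lintegral_mono fun ω =>
    ENNReal.rpow_le_rpow (enorm_toReal_sub_toReal_le (A ω) (B ω)) hp.le

lemma absMoment_timeToEReal_eq {p : ℝ} (hp : 0 < p) {A B : Ω → WithTop ℕ}
    (hA : ∀ᵐ ω ∂P, A ω ≠ ⊤) (hB : ∀ᵐ ω ∂P, B ω ≠ ⊤) :
    absMoment P p (fun ω => timeToEReal (A ω)) (fun ω => timeToEReal (B ω)) =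
      eLpNorm' (fun ω => (timeToEReal (A ω)).toReal - (timeToEReal (B ω)).toReal) p P ^ p := by
  rw [← lintegral_rpow_enorm_eq_rpow_eLpNorm' hp]
  refine lintegral_congr_ae ?_
  filter_upwards [hA, hB] with ω ha hb
  obtain ⟨a, ha⟩ := WithTop.ne_top_iff_exists.1 ha
  obtain ⟨b, hb⟩ := WithTop.ne_top_iff_exists.1 hb
  rw [← ha, ← hb]
  change ((((a : ℝ) : EReal) - ((b : ℝ) : EReal)).abs) ^ p = ‖(a : ℝ) - (b : ℝ)‖ₑ ^ p
  rw [← EReal.coe_sub, EReal.abs_def, Real.enorm_eq_ofReal_abs]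

end Risk

/-- The fraction of a step lost by rounding and the truncation of `l - Z_m` at `0` are both
negligible: as `l - s m ≥ s (l / s) ^ q`, the level is exceeded at time `m` by at most
`|S_m| - s (l / s) ^ q`, which is bounded by `S_m² / (s (l / s) ^ q)`. -/
lemma IsGaussianWalk.tendsto_eLpNorm_floor_sub {Ω : Type*} [MeasurableSpace Ω] {P : Measure Ω}
    [IsProbabilityMeasure P] {v : NNReal} {S : ℕ → Ω → ℝ} (hS : IsGaussianWalk P v S)
    {s p q : ℝ} (hs : 0 < s) (hp : 1 ≤ p) (hq : q ∈ Set.Ioo (1 / 2 : ℝ) 1) :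
    Tendsto (fun l => eLpNorm' (fun ω =>
      ((singleTime s q l + ⌊max 0 (l - (S (singleTime s q l) ω + s * singleTime s q l)) / s⌋₊ :
          ℕ) : ℝ) -
        (singleTime s q l +
          (l - (S (singleTime s q l) ω + s * singleTime s q l)) / s)) p P / ENNReal.ofReal √l)
      atTop (𝓝 0) := by
  set D := ENNReal.ofReal ((v : ℝ) ^ (2 * p / 2)) * gaussianAbsMoment (2 * p) with hD
  have hDtop : D < ∞ := ENNReal.mul_lt_top ENNReal.ofReal_lt_top
    (gaussianAbsMoment_lt_top (by positivity))
  set B := ENNReal.ofReal ((1 / s ^ 2) ^ p) with hB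
  refine tendsto_div_sqrt_of_le (a := 1 - q) (K := 3) (C := (1 + B * D) ^ (1 / p)) hs
    (by linarith [hq.1]) (ENNReal.rpow_lt_top_of_nonneg (by positivity) (by
      simp [hB, ENNReal.mul_eq_top, hDtop.ne])) ?_
  filter_upwards [eventually_ge_atTop s] with l hl
  have hl0 : 0 < l := hs.trans_le hl
  have hu : 1 ≤ l / s := by rwa [one_le_div hs]
  have hmb := singleTime_bounds hs hq.2 hl
  set u := l / s with hu'
  have hlu : l = s * u := by rw [hu']; field_simp
  set m := singleTime s q l with hm
  have huq : 0 < u ^ q := by positivity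
  have hmu : (m : ℝ) ≤ u := by linarith
  set w := u ^ (1 - q) with hw
  have hw0 : 1 ≤ w := Real.one_le_rpow hu (by linarith [hq.2])
  have hwu : w * u ^ q = u := by
    rw [hw, ← Real.rpow_add (by positivity)]; simp
  set e : Ω → ℝ := fun ω => ((m + ⌊max 0 (l - (S m ω + s * m)) / s⌋₊ : ℕ) : ℝ) -
      (m + (l - (S m ω + s * m)) / s) with he
  have hbd : ∀ ω, |e ω| ≤ w * (1 + 1 / s ^ 2 * (|S m ω| ^ 2 / u)) := by
    intro ω
    set x := S m ω
    set y := (l - (x + s * m)) / s with hy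
    have hey : e ω = (⌊max 0 (l - (x + s * m)) / s⌋₊ : ℝ) - y := by
      simp only [he]; push_cast; ring
    have hsq : 0 ≤ 1 / s ^ 2 * (|x| ^ 2 / u) := by positivity
    rw [hey]
    rcases le_total 0 (l - (x + s * m)) with h | h
    · rw [max_eq_right h]
      have hy0 : 0 ≤ y := div_nonneg h hs.le
      have h1 := Nat.floor_le hy0
      have h2 := Nat.lt_floor_add_one y
      have h3 : |(⌊y⌋₊ : ℝ) - y| ≤ 1 := by
        rw [abs_le]; constructor <;> linarith
      nlinarith
    · rw [max_eq_left h]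
      simp only [zero_div, Nat.floor_zero, Nat.cast_zero, zero_sub, abs_neg]
      have hy0 : y ≤ 0 := div_nonpos_of_nonpos_of_nonneg h hs.le
      rw [abs_of_nonpos hy0]
      have h1 : -y ≤ |x| / s - u ^ q := by
        have : -y = x / s - (u - m) := by rw [hy, hlu]; field_simp; ring
        rw [this]
        have : x / s ≤ |x| / s := by gcongr; exact le_abs_self x
        linarith [hmb.1]
      have h2 : w * (1 / s ^ 2 * (|x| ^ 2 / u)) = (|x| / s) ^ 2 / u ^ q := by
        have : 0 < w := by linarith
        have hu2 : |x| ^ 2 / u = |x| ^ 2 / (w * u ^ q) := by rw [hwu]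
        rw [hu2]
        field_simp
      have h3 : |x| / s - u ^ q ≤ (|x| / s) ^ 2 / u ^ q := by
        rw [le_div_iff₀ huq]
        nlinarith [sq_nonneg (|x| / s - u ^ q), mul_nonneg (div_nonneg (abs_nonneg x) hs.le) huq.le]
      rw [mul_add, h2]
      linarith
  have hpt : ∀ ω, ‖e ω‖ₑ ^ p ≤ ENNReal.ofReal ((3 * w) ^ p) *
      (1 + B * (ENNReal.ofReal (1 / u ^ p) * ENNReal.ofReal (|S m ω| ^ (2 * p)))) := by
    intro ω
    rw [enorm_rpow_eq_ofReal _ (by linarith), hB, ← ENNReal.ofReal_mul (by positivity),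
      ← ENNReal.ofReal_mul (by positivity), ← ENNReal.ofReal_one,
      ← ENNReal.ofReal_add (by norm_num) (by positivity), ← ENNReal.ofReal_mul (by positivity)]
    refine ENNReal.ofReal_le_ofReal ?_
    refine (Real.rpow_le_rpow (abs_nonneg _) (hbd ω) (by linarith)).trans ?_
    rw [Real.mul_rpow (by positivity) (by positivity), mul_comm 3 w,
      Real.mul_rpow (by positivity) (by norm_num), mul_assoc]
    refine mul_le_mul_of_nonneg_left ?_ (by positivity)
    -- The third summand of `add_add_rpow_le` is not needed here, so it is set to `0`.
    have h1 := add_add_rpow_le (x := 1) (y := 1 / s ^ 2 * (|S m ω| ^ 2 / u)) (z := 0)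
      zero_le_one (by positivity) le_rfl (p := p) (by linarith)
    have h2 : (|S m ω| ^ 2 / u) ^ p = 1 / u ^ p * |S m ω| ^ (2 * p) := by
      rw [Real.div_rpow (by positivity) (by positivity), Real.rpow_mul (abs_nonneg _),
        Real.rpow_two]
      ring
    rwa [Real.one_rpow, Real.zero_rpow (by linarith), add_zero, add_zero,
      Real.mul_rpow (by positivity) (by positivity), h2] at h1
  have hint : ∫⁻ ω, ‖e ω‖ₑ ^ p ∂P ≤ ENNReal.ofReal ((3 * w) ^ p) * (1 + B * D) := by
    refine (lintegral_mono hpt).trans ?_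
    rw [lintegral_const_mul' _ _ ENNReal.ofReal_ne_top, lintegral_add_left (by fun_prop),
      lintegral_const_mul' _ _ ENNReal.ofReal_ne_top,
      lintegral_const_mul' _ _ ENNReal.ofReal_ne_top,
      hS.lintegral_abs_rpow, ← mul_assoc (ENNReal.ofReal (1 / u ^ p)),
      ← ENNReal.ofReal_mul (by positivity)]
    simp only [lintegral_const, measure_univ, mul_one]
    rw [hD]
    gcongr
    rw [Real.mul_rpow (by positivity) (by positivity), one_div_mul_eq_div,
      div_le_iff₀ (by positivity)]
    gcongr
    rw [mul_div_cancel_left₀ p two_ne_zero]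
    gcongr
  rw [eLpNorm'_eq_lintegral_enorm]
  refine (ENNReal.rpow_le_rpow hint (by positivity)).trans_eq ?_
  rw [ENNReal.mul_rpow_of_nonneg _ _ (by positivity),
    ENNReal.ofReal_rpow_of_nonneg (by positivity) (by positivity), ← Real.rpow_mul (by positivity),
    mul_one_div_cancel (by linarith), Real.rpow_one]

/-! ### The scale of the limit -/

section Asymptotics

lemma tendsto_singleTime_div {s q : ℝ} (hs : 0 < s) (hq : q < 1) :
    Tendsto (fun l => (singleTime s q l : ℝ) / (l / s)) atTop (𝓝 1) := by
  have hu : Tendsto (fun l : ℝ => l / s) atTop atTop := tendsto_id.atTop_div_const hs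
  have h1 : Tendsto (fun l : ℝ => 1 - (l / s) ^ (-(1 - q)) - (l / s)⁻¹) atTop (𝓝 1) := by
    have h2 := (tendsto_rpow_neg_atTop (y := 1 - q) (by linarith)).comp hu
    have h3 := tendsto_inv_atTop_zero.comp hu
    simpa using (h2.const_sub 1).sub h3
  refine tendsto_of_tendsto_of_tendsto_of_le_of_le' h1 tendsto_const_nhds ?_ ?_
  · filter_upwards [eventually_ge_atTop s] with l hl
    have hb := (singleTime_bounds hs hq hl).2
    have hu0 : 0 < l / s := div_pos (hs.trans_le hl) hs
    rw [le_div_iff₀ hu0, sub_mul, sub_mul, ← Real.rpow_add_one hu0.ne', inv_mul_cancel₀ hu0.ne']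
    have : -(1 - q) + 1 = q := by ring
    rw [this]
    linarith
  · filter_upwards [eventually_ge_atTop s] with l hl
    have hb := (singleTime_bounds hs hq hl).1
    have hu0 : 0 < l / s := div_pos (hs.trans_le hl) hs
    rw [div_le_one hu0]
    have : 0 ≤ (l / s) ^ q := by positivity
    linarith

lemma tendsto_div_rpow_of_bounds {F ρ δ₁ δ₂ c : ℝ → ℝ≥0∞} {p : ℝ} (hp : 0 < p)
    (hρ : Tendsto (fun l => ρ l / c l) atTop (𝓝 1))
    (h₁ : Tendsto (fun l => δ₁ l / c l) atTop (𝓝 0))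
    (h₂ : Tendsto (fun l => δ₂ l / c l) atTop (𝓝 0))
    (hc : ∀ᶠ l in atTop, c l ≠ 0)
    (hlo : ∀ᶠ l in atTop, (ρ l - δ₁ l) ^ p ≤ F l)
    (hhi : ∀ᶠ l in atTop, F l ≤ (ρ l + δ₂ l) ^ p) :
    Tendsto (fun l => F l / c l ^ p) atTop (𝓝 1) := by
  have hl : Tendsto (fun l => (ρ l / c l - δ₁ l / c l) ^ p) atTop (𝓝 1) := by
    have h := (ENNReal.continuous_rpow_const (y := p)).tendsto (1 - 0)
    simpa [Function.comp_def] using h.comp (ENNReal.Tendsto.sub hρ h₁ (by simp))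
  have hu : Tendsto (fun l => (ρ l / c l + δ₂ l / c l) ^ p) atTop (𝓝 1) := by
    have h := (ENNReal.continuous_rpow_const (y := p)).tendsto (1 + 0)
    simpa [Function.comp_def] using h.comp (hρ.add h₂)
  refine tendsto_of_tendsto_of_tendsto_of_le_of_le' hl hu ?_ ?_
  · filter_upwards [hlo, hc] with l h hc
    rw [← ENNReal.sub_div fun _ _ => hc, ENNReal.div_rpow_of_nonneg _ _ hp.le]
    exact ENNReal.div_le_div_right h _
  · filter_upwards [hhi] with l h
    rw [← ENNReal.add_div, ENNReal.div_rpow_of_nonneg _ _ hp.le]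
    exact ENNReal.div_le_div_right h _

lemma IsGaussianWalk.eLpNorm_eq {Ω : Type*} [MeasurableSpace Ω] {P : Measure Ω} {v : NNReal}
    {S : ℕ → Ω → ℝ} (hS : IsGaussianWalk P v S) (t : ℕ) {p : ℝ} (hp : 0 < p) :
    eLpNorm' (S t) p P = ENNReal.ofReal √((v : ℝ) * t) * gaussianAbsMoment p ^ (1 / p) := by
  rw [eLpNorm'_eq_lintegral_enorm]
  simp_rw [enorm_rpow_eq_ofReal _ hp.le]
  rw [hS.lintegral_abs_rpow, ENNReal.mul_rpow_of_nonneg _ _ (by positivity),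
    ENNReal.ofReal_rpow_of_nonneg (by positivity) (by positivity), ← Real.rpow_mul (by positivity),
    Real.sqrt_eq_rpow]
  congr 3
  field_simp

end Asymptotics

/-- The `L^p` scale `√(v l / s) ‖N‖_p` of a Gaussian walk with variance `v` per step at the time
`l / s`. -/
noncomputable def lpScale (v : NNReal) (s p l : ℝ) : ℝ≥0∞ :=
  ENNReal.ofReal √((v : ℝ) * (l / s)) * gaussianAbsMoment p ^ (1 / p)

section Scale

variable {v : NNReal} {s p : ℝ}

lemma gaussianAbsMoment_rpow_ne (hp : 0 < p) :
    gaussianAbsMoment p ^ (1 / p) ≠ 0 ∧ gaussianAbsMoment p ^ (1 / p) ≠ ∞ := by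
  constructor
  · exact (ENNReal.rpow_pos gaussianAbsMoment_pos (gaussianAbsMoment_lt_top hp).ne).ne'
  · exact ENNReal.rpow_ne_top_of_nonneg (by positivity) (gaussianAbsMoment_lt_top hp).ne

lemma lpScale_ne_zero (hv : 0 < v) (hs : 0 < s) (hp : 0 < p) {l : ℝ} (hl : 0 < l) :
    lpScale v s p l ≠ 0 := by
  have : 0 < (v : ℝ) * (l / s) := by positivity
  exact mul_ne_zero (ENNReal.ofReal_pos.2 (Real.sqrt_pos.2 this)).ne'
    (gaussianAbsMoment_rpow_ne hp).1

lemma tendsto_div_lpScale_of_div_sqrt (hv : 0 < v) (hs : 0 < s) (hp : 0 < p) {δ : ℝ → ℝ≥0∞}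
    (h : Tendsto (fun l => δ l / ENNReal.ofReal √l) atTop (𝓝 0)) :
    Tendsto (fun l => δ l / lpScale v s p l) atTop (𝓝 0) := by
  set K := ENNReal.ofReal √((v : ℝ) / s) * gaussianAbsMoment p ^ (1 / p) with hK
  have hvs : 0 < (v : ℝ) / s := by positivity
  have hK0 : K ≠ 0 := mul_ne_zero (ENNReal.ofReal_pos.2 (Real.sqrt_pos.2 hvs)).ne'
    (gaussianAbsMoment_rpow_ne hp).1
  have h1 := ENNReal.Tendsto.div_const h (b := K) (Or.inr hK0)
  rw [ENNReal.zero_div] at h1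
  refine h1.congr' ?_
  filter_upwards [eventually_gt_atTop 0] with l hl
  have e : lpScale v s p l = ENNReal.ofReal √l * K := by
    rw [lpScale, hK, ← mul_assoc, ← ENNReal.ofReal_mul (by positivity), ← Real.sqrt_mul hl.le]
    congr 3
    ring
  have hl0 : ENNReal.ofReal √l ≠ 0 := by simpa using hl
  rw [e, div_eq_mul_inv, div_eq_mul_inv, div_eq_mul_inv,
    ENNReal.mul_inv (Or.inl hl0) (Or.inl ENNReal.ofReal_ne_top), mul_assoc]

lemma IsGaussianWalk.tendsto_eLpNorm_div_lpScale {Ω : Type*} [MeasurableSpace Ω] {P : Measure Ω}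
    {S : ℕ → Ω → ℝ} {q : ℝ} (hS : IsGaussianWalk P v S) (hv : 0 < v) (hs : 0 < s) (hp : 0 < p)
    (hq : q < 1) :
    Tendsto (fun l => eLpNorm' (S (singleTime s q l)) p P / lpScale v s p l) atTop (𝓝 1) := by
  have h1 : Tendsto (fun l => ENNReal.ofReal √((singleTime s q l : ℝ) / (l / s))) atTop (𝓝 1) := by
    have := ENNReal.tendsto_ofReal (tendsto_singleTime_div hs hq).sqrt
    simpa using this
  refine h1.congr' ?_
  filter_upwards [eventually_gt_atTop 0] with l hl
  have hls : 0 < (v : ℝ) * (l / s) := by positivity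
  rw [hS.eLpNorm_eq _ hp, lpScale, ENNReal.mul_div_mul_right _ _ (gaussianAbsMoment_rpow_ne hp).1
    (gaussianAbsMoment_rpow_ne hp).2, ← ENNReal.ofReal_div_of_pos (Real.sqrt_pos.2 hls),
    ← Real.sqrt_div' _ hls.le, mul_div_mul_left _ _ (by positivity)]

end Scale

/-! ### The observation model -/

section Model

variable {Ω : Type*}

/-- The centered part of the estimate: `X̂_t = estimateNoise t + s t`. -/
noncomputable def estimateNoise (ε : ℝ) (V W : ℕ → Ω → ℝ) (t : ℕ) (ω : Ω) : ℝ :=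
  1 / (1 + ε ^ 2) * ∑ i ∈ Finset.range t, V i ω + ε / (1 + ε ^ 2) * ∑ i ∈ Finset.range t, W i ω

/-- The estimation error `(X_t - X̂_t) / s`, measured in time units. -/
noncomputable def delayError (s ε : ℝ) (V W : ℕ → Ω → ℝ) (t : ℕ) (ω : Ω) : ℝ :=
  ε ^ 2 / ((1 + ε ^ 2) * s) * ∑ i ∈ Finset.range t, V i ω +
    -ε / ((1 + ε ^ 2) * s) * ∑ i ∈ Finset.range t, W i ω

/-- The variance per step of `delayError`. -/
noncomputable def delayVariance (s ε : ℝ) : NNReal :=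
  Real.toNNReal (ε ^ 2 / ((1 + ε ^ 2) * s ^ 2))

lemma coe_delayVariance (s ε : ℝ) :
    (delayVariance s ε : ℝ) = ε ^ 2 / ((1 + ε ^ 2) * s ^ 2) :=
  Real.coe_toNNReal _ (by positivity)

lemma mmse_obs (s ε : ℝ) (V W : ℕ → Ω → ℝ) (t : ℕ) (ω : Ω) :
    mmse s ε t (obs s ε V W t ω) = estimateNoise ε V W t ω + s * t := by
  have : 1 + ε ^ 2 ≠ 0 := by positivity
  unfold mmse obs walk estimateNoise
  field_simp
  ring

lemma delayError_eq {s : ℝ} (hs : s ≠ 0) (ε : ℝ) (V W : ℕ → Ω → ℝ) (t : ℕ) (ω : Ω) :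
    delayError s ε V W t ω =
      (∑ i ∈ Finset.range t, V i ω - estimateNoise ε V W t ω) / s := by
  have : 1 + ε ^ 2 ≠ 0 := by positivity
  unfold delayError estimateNoise
  field_simp
  ring

lemma seqRule_obs (s ε l : ℝ) (V W : ℕ → Ω → ℝ) :
    seqRule s ε (obs s ε V W) l =
      firstPassage (fun t ω => estimateNoise ε V W t ω + s * t) l := by
  simp only [seqRule, mmse_obs]

lemma lpScale_rpow_eq_C1 {s ε p l : ℝ} (hs : 0 < s) (hp : 0 < p) (hl : 0 < l) :
    lpScale (delayVariance s ε) s p l ^ p = C1 l s ε p := by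
  have e : (delayVariance s ε : ℝ) * (l / s) = l * ε ^ 2 / (s ^ 3 * (1 + ε ^ 2)) := by
    rw [coe_delayVariance]
    field_simp
  rw [lpScale, e, C1, ENNReal.mul_rpow_of_nonneg _ _ hp.le, ← ENNReal.rpow_mul,
    one_div_mul_cancel hp.ne', ENNReal.rpow_one, gaussianAbsMoment,
    ENNReal.ofReal_rpow_of_nonneg (by positivity) hp.le, Real.sqrt_eq_rpow,
    ← Real.rpow_mul (by positivity)]
  congr 3
  ring

variable [MeasurableSpace Ω] {P : Measure Ω}

lemma map_neg_eq_of_map_eq_gaussianReal {R : Ω → ℝ} {v : NNReal} (hR : Measurable R)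
    (h : P.map R = gaussianReal 0 v) : P.map (fun ω => -R ω) = P.map R := by
  have h1 : P.map (fun ω => -R ω) = (P.map R).map (fun x => -x) := by
    rw [Measure.map_map measurable_neg hR]
    rfl
  rw [h1, h, gaussianReal_map_neg, neg_zero]

/-- `V_1, V_2, …` and `W_1, W_2, …` are two independent sequences of i.i.d. standard Gaussian
variables. -/
structure IsGaussianNoise (P : Measure Ω) (V W : ℕ → Ω → ℝ) : Prop where
  measurable_left : ∀ i, Measurable (V i)
  measurable_right : ∀ i, Measurable (W i)
  map_left : ∀ i, P.map (V i) = gaussianReal 0 1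
  map_right : ∀ i, P.map (W i) = gaussianReal 0 1
  iIndepFun_left : iIndepFun V P
  iIndepFun_right : iIndepFun W P
  indepFun : IndepFun (fun ω i => V i ω) (fun ω i => W i ω) P

namespace IsGaussianNoise

variable {V W : ℕ → Ω → ℝ}

lemma isGaussianWalk_left [IsProbabilityMeasure P] (h : IsGaussianNoise P V W) :
    IsGaussianWalk P 1 (fun t ω => ∑ i ∈ Finset.range t, V i ω) :=
  isGaussianWalk_sum h.measurable_left h.map_left h.iIndepFun_left

lemma isGaussianWalk_right [IsProbabilityMeasure P] (h : IsGaussianNoise P V W) :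
    IsGaussianWalk P 1 (fun t ω => ∑ i ∈ Finset.range t, W i ω) :=
  isGaussianWalk_sum h.measurable_right h.map_right h.iIndepFun_right

lemma measurable_obs (h : IsGaussianNoise P V W) (s ε : ℝ) (t : ℕ) :
    Measurable (obs s ε V W t) :=
  (stronglyMeasurable_obs s ε h.measurable_left h.measurable_right t).measurable

lemma measurable_walk [IsProbabilityMeasure P] (h : IsGaussianNoise P V W) (s : ℝ) (t : ℕ) :
    Measurable (walk s V t) :=
  (h.isGaussianWalk_left.measurable t).add_const _

lemma indepFun_partialSums (h : IsGaussianNoise P V W) :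
    IndepFun (fun ω t => ∑ i ∈ Finset.range t, V i ω)
      (fun ω t => ∑ i ∈ Finset.range t, W i ω) P :=
  h.indepFun.comp (φ := fun (x : ℕ → ℝ) (t : ℕ) => ∑ i ∈ Finset.range t, x i)
    (ψ := fun (x : ℕ → ℝ) (t : ℕ) => ∑ i ∈ Finset.range t, x i) (by fun_prop) (by fun_prop)

lemma isGaussianWalk_estimateNoise [IsProbabilityMeasure P] (h : IsGaussianNoise P V W) (ε : ℝ) :
    IsGaussianWalk P (Real.toNNReal (1 / (1 + ε ^ 2))) (estimateNoise ε V W) := by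
  refine h.isGaussianWalk_left.linear_combination h.isGaussianWalk_right
    h.indepFun_partialSums (1 / (1 + ε ^ 2)) (ε / (1 + ε ^ 2)) ?_
  rw [Real.coe_toNNReal _ (by positivity)]
  simp
  field_simp

lemma isGaussianWalk_delayError [IsProbabilityMeasure P] (h : IsGaussianNoise P V W) {s : ℝ}
    (hs : s ≠ 0) (ε : ℝ) :
    IsGaussianWalk P (delayVariance s ε) (delayError s ε V W) := by
  refine h.isGaussianWalk_left.linear_combination h.isGaussianWalk_right
    h.indepFun_partialSums (ε ^ 2 / ((1 + ε ^ 2) * s)) (-ε / ((1 + ε ^ 2) * s)) ?_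
  rw [coe_delayVariance]
  simp
  field_simp
  ring

lemma indepFun_obs_delayError [IsProbabilityMeasure P] (h : IsGaussianNoise P V W) (s ε : ℝ)
    (m : ℕ) :
    IndepFun (fun ω t => obs s ε V W t ω) (delayError s ε V W m) P := by
  have hind := (indepFun_rotated h.measurable_left h.measurable_right h.map_left h.map_right
    h.iIndepFun_left h.iIndepFun_right h.indepFun ε).comp
    (φ := fun (x : ℕ → ℝ) (t : ℕ) => ∑ i ∈ Finset.range t, x i + s * t)
    (ψ := fun (x : ℕ → ℝ) => ε / ((1 + ε ^ 2) * s) * ∑ i ∈ Finset.range m, x i)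
    (by fun_prop) (by fun_prop)
  convert! hind using 1
  · ext ω t
    simp only [obs, walk, Function.comp_apply, Finset.sum_add_distrib, Finset.mul_sum]
    ring
  · ext ω
    simp only [delayError, Function.comp_apply, Finset.sum_sub_distrib, ← Finset.mul_sum]
    ring

/-- Given the observations, `(X_m - X̂_m) / s` is symmetric, and `τ` is
`m + (l - X̂_m) / s - (X_m - X̂_m) / s` up to an error `δ`. So no estimator does better than
`‖(X_m - X̂_m) / s‖_p - δ`. -/
lemma sub_rpow_le_bestRisk [IsProbabilityMeasure P] (h : IsGaussianNoise P V W) {s p : ℝ}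
    (hs : 0 < s) (hp : 1 ≤ p) (ε l : ℝ) (m : ℕ) :
    (eLpNorm' (delayError s ε V W m) p P -
      eLpNorm' (fun ω => (timeToEReal (firstPassage (walk s V) l ω)).toReal -
        (m + (l - (∑ i ∈ Finset.range m, V i ω + s * m)) / s)) p P) ^ p ≤
      bestRisk P p s ε V W l := by
  have hp0 : 0 < p := by linarith
  have hR := h.isGaussianWalk_delayError hs.ne' ε
  refine le_iInf fun ⟨f, hf⟩ => ?_
  refine le_trans ?_ (rpow_eLpNorm_le_absMoment hp0 _ _)
  refine ENNReal.rpow_le_rpow ?_ hp0.le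
  rw [tsub_le_iff_right]
  have hYm : Measurable fun ω t => obs s ε V W t ω := measurable_pi_lambda _ (h.measurable_obs s ε)
  have hsymm : P.map (fun ω => -delayError s ε V W m ω) = P.map (delayError s ε V W m) := by
    refine map_neg_eq_of_map_eq_gaussianReal (v := delayVariance s ε * m) (hR.measurable m) ?_
    simpa [hR.zero] using hR.map_increment 0 m
  have hh : Measurable fun y : ℕ → ℝ => m + (l - mmse s ε m (y m)) / s - (f y).toReal := by
    unfold mmse
    fun_prop
  have h1 := eLpNorm_le_eLpNorm_sub_of_indepFun hYm (hR.measurable m)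
    (h.indepFun_obs_delayError s ε m) hsymm hh hp
  refine h1.trans ?_
  set τ : Ω → ℝ := fun ω => (timeToEReal (firstPassage (walk s V) l ω)).toReal with hτ
  have hτm : Measurable τ := (measurable_timeToEReal_firstPassage
    (h.measurable_walk s) l).ereal_toReal
  have hfm : Measurable fun ω => (f fun t => obs s ε V W t ω).toReal :=
    (hf.comp hYm).ereal_toReal
  have h2 := eLpNorm'_add_le (μ := P)
    (f := fun ω => τ ω - (f fun t => obs s ε V W t ω).toReal)
    (g := fun ω => (m + (l - (∑ i ∈ Finset.range m, V i ω + s * m)) / s) - τ ω)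
    (hτm.sub hfm).aestronglyMeasurable
    (by
      have := h.isGaussianWalk_left.measurable m
      refine Measurable.aestronglyMeasurable ?_
      fun_prop) hp
  have hswap : ∀ f g : Ω → ℝ, eLpNorm' (fun ω => f ω - g ω) p P =
      eLpNorm' (fun ω => g ω - f ω) p P := by
    intro f g
    rw [← eLpNorm'_neg]
    congr 1
    ext ω
    simp
  rw [hswap τ fun ω => (f fun t => obs s ε V W t ω).toReal,
    hswap (fun ω => m + (l - (∑ i ∈ Finset.range m, V i ω + s * m)) / s) τ] at h2
  refine le_of_eq_of_le ?_ h2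
  congr 1
  ext ω
  simp only [Pi.add_apply, mmse_obs, delayError_eq hs.ne']
  field_simp
  ring

/-- A rule `η` that is close to `m + (l - X̂_m) / s` has a risk of at most that of
`(X_m - X̂_m) / s`, up to small errors. -/
lemma risk_le_add_rpow [IsProbabilityMeasure P] (h : IsGaussianNoise P V W) {s p : ℝ}
    (hs : 0 < s) (hp : 1 ≤ p) (ε l : ℝ) (m : ℕ)
    {η : Ω → WithTop ℕ} (hη : Measurable fun ω => timeToEReal (η ω)) (hfin : ∀ᵐ ω ∂P, η ω ≠ ⊤) :
    risk P p s V l (fun ω => timeToEReal (η ω)) ≤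
      (eLpNorm' (delayError s ε V W m) p P +
        (eLpNorm' (fun ω => (timeToEReal (η ω)).toReal -
          (m + (l - (estimateNoise ε V W m ω + s * m)) / s)) p P +
        eLpNorm' (fun ω => (timeToEReal (firstPassage (walk s V) l ω)).toReal -
          (m + (l - (∑ i ∈ Finset.range m, V i ω + s * m)) / s)) p P)) ^ p := by
  have hp0 : 0 < p := by linarith
  have hR := h.isGaussianWalk_delayError hs.ne' ε
  have hE := h.isGaussianWalk_estimateNoise ε
  have hEm := hE.measurable m
  have hτfin : ∀ᵐ ω ∂P, firstPassage (walk s V) l ω ≠ ⊤ :=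
    h.isGaussianWalk_left.ae_firstPassage_ne_top hs l
  rw [risk, absMoment_timeToEReal_eq hp0 hfin hτfin]
  refine ENNReal.rpow_le_rpow ?_ hp0.le
  set τ : Ω → ℝ := fun ω => (timeToEReal (firstPassage (walk s V) l ω)).toReal with hτ
  have hτm : Measurable τ := (measurable_timeToEReal_firstPassage
    (h.measurable_walk s) l).ereal_toReal
  set g : Ω → ℝ := fun ω => (timeToEReal (η ω)).toReal with hg
  have hgm : Measurable g := hη.ereal_toReal
  set D : Ω → ℝ := fun ω => m + (l - (∑ i ∈ Finset.range m, V i ω + s * m)) / s with hD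
  set D' : Ω → ℝ := fun ω => m + (l - (estimateNoise ε V W m ω + s * m)) / s with hD'
  have := h.isGaussianWalk_left.measurable m
  have hDm : Measurable D := by fun_prop
  have hDm' : Measurable D' := by fun_prop
  have h1 := eLpNorm'_add_le (μ := P) (f := delayError s ε V W m)
    (g := fun ω => (g ω - D' ω) + (D ω - τ ω))
    (hR.measurable m).aestronglyMeasurable
    ((hgm.sub hDm').add (hDm.sub hτm)).aestronglyMeasurable hp
  have h2 := eLpNorm'_add_le (μ := P) (f := fun ω => g ω - D' ω) (g := fun ω => D ω - τ ω)
    (hgm.sub hDm').aestronglyMeasurable (hDm.sub hτm).aestronglyMeasurable hp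
  have hswap : eLpNorm' (fun ω => D ω - τ ω) p P = eLpNorm' (fun ω => τ ω - D ω) p P := by
    rw [← eLpNorm'_neg]
    congr 1
    ext ω
    simp
  rw [hswap] at h2
  have e : (fun ω => g ω - τ ω) =
      delayError s ε V W m + fun ω => (g ω - D' ω) + (D ω - τ ω) := by
    ext ω
    simp only [Pi.add_apply, delayError_eq hs.ne', hD, hD']
    field_simp
    ring
  change eLpNorm' (fun ω => g ω - τ ω) p P ≤ _
  rw [e]
  refine h1.trans ?_
  gcongr
  exact h2

end IsGaussianNoise

end Model

/-! ### Asymptotics of the risks -/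

namespace IsGaussianNoise

variable {Ω : Type*} [MeasurableSpace Ω] {P : Measure Ω}
  {V W : ℕ → Ω → ℝ} {s ε p q : ℝ}

lemma bestRisk_le_of_comp (s ε p l : ℝ) {f : (ℕ → ℝ) → EReal} (hf : Measurable f) :
    bestRisk P p s ε V W l ≤ risk P p s V l (fun ω => f (fun t => obs s ε V W t ω)) :=
  iInf_le (fun f : {f : (ℕ → ℝ) → EReal // Measurable f} =>
    risk P p s V l (fun ω => f.1 (fun t => obs s ε V W t ω))) ⟨f, hf⟩

lemma bestRisk_le_risk_seqRule (s ε p l : ℝ) :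
    bestRisk P p s ε V W l ≤
      risk P p s V l (fun ω => timeToEReal (seqRule s ε (obs s ε V W) l ω)) := by
  have hf : Measurable fun y : ℕ → ℝ =>
      timeToEReal (seqRule s ε (fun t (y : ℕ → ℝ) => y t) l y) :=
    measurable_timeToEReal_firstPassage (fun t => by unfold mmse; fun_prop) l
  exact bestRisk_le_of_comp s ε p l hf

lemma bestRisk_le_risk_singleRule (s ε p q l : ℝ) :
    bestRisk P p s ε V W l ≤
      risk P p s V l (fun ω => timeToEReal (singleRule s ε q (obs s ε V W) l ω)) := by
  have hf : Measurable fun y : ℕ → ℝ =>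
      timeToEReal (singleRule s ε q (fun t (y : ℕ → ℝ) => y t) l y) :=
    measurable_timeToEReal_singleRule fun t => measurable_pi_apply t
  exact bestRisk_le_of_comp s ε p l hf

/-- Any quantity that is at least the best risk, and at most the risk of a rule that is
asymptotically as good as `m + (l - X̂_m) / s`, is asymptotic to `C₁`. -/
lemma tendsto_div_C1 [IsProbabilityMeasure P] (h : IsGaussianNoise P V W) (hs : 0 < s)
    (hε : 0 < ε) (hp : 1 ≤ p)
    (hq : q ∈ Set.Ioo (1 / 2 : ℝ) 1) {F : ℝ → ℝ≥0∞} {η : ℝ → Ω → WithTop ℕ}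
    (hη : ∀ l, Measurable fun ω => timeToEReal (η l ω)) (hfin : ∀ l, ∀ᵐ ω ∂P, η l ω ≠ ⊤)
    (happrox : Tendsto (fun l => eLpNorm' (fun ω => (timeToEReal (η l ω)).toReal -
      (singleTime s q l + (l - (estimateNoise ε V W (singleTime s q l) ω +
        s * singleTime s q l)) / s)) p P / ENNReal.ofReal √l) atTop (𝓝 0))
    (hlo : ∀ l, bestRisk P p s ε V W l ≤ F l)
    (hhi : ∀ l, F l ≤ risk P p s V l (fun ω => timeToEReal (η l ω))) :
    Tendsto (fun l => F l / C1 l s ε p) atTop (𝓝 1) := by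
  have hp0 : 0 < p := by linarith
  have hv : 0 < delayVariance s ε := by
    rw [← NNReal.coe_pos, coe_delayVariance]
    positivity
  have hτ : Tendsto (fun l => eLpNorm' (fun ω =>
      (timeToEReal (firstPassage (walk s V) l ω)).toReal -
        (singleTime s q l + (l - (∑ i ∈ Finset.range (singleTime s q l), V i ω +
          s * singleTime s q l)) / s)) p P / ENNReal.ofReal √l) atTop (𝓝 0) :=
    h.isGaussianWalk_left.tendsto_eLpNorm_firstPassage_sub hs hp hq
  have hτη := happrox.add hτ
  simp only [← ENNReal.add_div, add_zero] at hτη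
  have key := tendsto_div_rpow_of_bounds hp0
    ((h.isGaussianWalk_delayError hs.ne' ε).tendsto_eLpNorm_div_lpScale hv hs hp0 hq.2)
    (tendsto_div_lpScale_of_div_sqrt hv hs hp0 hτ)
    (tendsto_div_lpScale_of_div_sqrt hv hs hp0 hτη)
    ((eventually_gt_atTop 0).mono fun l hl => lpScale_ne_zero hv hs hp0 hl)
    (Eventually.of_forall fun l => (h.sub_rpow_le_bestRisk hs hp ε l _).trans (hlo l))
    (Eventually.of_forall fun l =>
      (hhi l).trans (h.risk_le_add_rpow hs hp ε l _ (hη l) (hfin l)))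
  refine key.congr' ?_
  filter_upwards [eventually_gt_atTop 0] with l hl
  rw [lpScale_rpow_eq_C1 hs hp0 hl]

end IsGaussianNoise

lemma C1_ne_zero_and_ne_top {s ε p l : ℝ} (hs : 0 < s) (hε : 0 < ε) (hp : 0 < p) (hl : 0 < l) :
    C1 l s ε p ≠ 0 ∧ C1 l s ε p ≠ ∞ := by
  have h1 : 0 < (l * ε ^ 2 / (s ^ 3 * (1 + ε ^ 2))) ^ (p / 2) := by positivity
  exact ⟨mul_ne_zero (ENNReal.ofReal_pos.2 h1).ne' gaussianAbsMoment_pos.ne',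
    ENNReal.mul_ne_top ENNReal.ofReal_ne_top (gaussianAbsMoment_lt_top hp).ne⟩

lemma tendsto_div_of_tendsto_div {F G C : ℝ → ℝ≥0∞}
    (hF : Tendsto (fun l => F l / C l) atTop (𝓝 1)) (hG : Tendsto (fun l => G l / C l) atTop (𝓝 1))
    (hC : ∀ᶠ l in atTop, C l ≠ 0 ∧ C l ≠ ∞) :
    Tendsto (fun l => F l / G l) atTop (𝓝 1) := by
  have h := ENNReal.Tendsto.div hF (by simp) hG (by simp)
  rw [div_one] at h
  refine h.congr' ?_
  filter_upwards [hC] with l hl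
  rw [div_eq_mul_inv, div_eq_mul_inv (F l), div_eq_mul_inv (G l),
    ENNReal.mul_inv (Or.inr (by simpa using hl.1)) (Or.inr (by simpa using hl.2)),
    inv_inv, mul_mul_mul_comm, mul_comm (C l)⁻¹, ENNReal.mul_inv_cancel hl.1 hl.2, mul_one,
    ← div_eq_mul_inv]

end NoisyTracking

theorem theorem2 {Ω : Type*} [MeasurableSpace Ω] (P : Measure Ω) [IsProbabilityMeasure P]
    (V W : ℕ → Ω → ℝ)
    (hVm : ∀ i, Measurable (V i)) (hWm : ∀ i, Measurable (W i))
    (hV : ∀ i, P.map (V i) = gaussianReal 0 1) (hW : ∀ i, P.map (W i) = gaussianReal 0 1)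
    (hVi : iIndepFun V P) (hWi : iIndepFun W P)
    (hVW : IndepFun (fun ω i => V i ω) (fun ω i => W i ω) P)
    (s ε p q : ℝ) (hs : 0 < s) (hε : 0 < ε) (hp : 1 ≤ p) (hq : q ∈ Set.Ioo (1 / 2 : ℝ) 1) :
    -- both rules are stopping times of the observation process
    (∀ l : ℝ, 0 < l →
      IsStoppingTime (NoisyTracking.obsFiltration s ε hVm hWm)
        (NoisyTracking.seqRule s ε (NoisyTracking.obs s ε V W) l) ∧
      IsStoppingTime (NoisyTracking.obsFiltration s ε hVm hWm)
        (NoisyTracking.singleRule s ε q (NoisyTracking.obs s ε V W) l)) ∧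
    -- the best risk with access to all observations
    Tendsto (fun l : ℝ => NoisyTracking.bestRisk P p s ε V W l / NoisyTracking.C1 l s ε p)
      atTop (𝓝 1) ∧
    -- the sequential rule
    Tendsto (fun l : ℝ =>
      NoisyTracking.risk P p s V l (fun ω => NoisyTracking.timeToEReal
        (NoisyTracking.seqRule s ε (NoisyTracking.obs s ε V W) l ω)) /
      NoisyTracking.bestRisk P p s ε V W l) atTop (𝓝 1) ∧
    Tendsto (fun l : ℝ =>
      NoisyTracking.risk P p s V l (fun ω => NoisyTracking.timeToEReal
        (NoisyTracking.seqRule s ε (NoisyTracking.obs s ε V W) l ω)) /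
      NoisyTracking.C1 l s ε p) atTop (𝓝 1) ∧
    -- the single-observation rule
    Tendsto (fun l : ℝ =>
      NoisyTracking.risk P p s V l (fun ω => NoisyTracking.timeToEReal
        (NoisyTracking.singleRule s ε q (NoisyTracking.obs s ε V W) l ω)) /
      NoisyTracking.bestRisk P p s ε V W l) atTop (𝓝 1) ∧
    Tendsto (fun l : ℝ =>
      NoisyTracking.risk P p s V l (fun ω => NoisyTracking.timeToEReal
        (NoisyTracking.singleRule s ε q (NoisyTracking.obs s ε V W) l ω)) /
      NoisyTracking.C1 l s ε p) atTop (𝓝 1) := by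
  have hN : NoisyTracking.IsGaussianNoise P V W := ⟨hVm, hWm, hV, hW, hVi, hWi, hVW⟩
  have hE := hN.isGaussianWalk_estimateNoise ε
  have hseq : Tendsto (fun l : ℝ =>
      NoisyTracking.risk P p s V l (fun ω => NoisyTracking.timeToEReal
        (NoisyTracking.seqRule s ε (NoisyTracking.obs s ε V W) l ω)) /
      NoisyTracking.C1 l s ε p) atTop (𝓝 1) := by
    refine hN.tendsto_div_C1 hs hε hp hq
      (η := NoisyTracking.seqRule s ε (NoisyTracking.obs s ε V W)) (fun l => ?_) (fun l => ?_) ?_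
      (NoisyTracking.IsGaussianNoise.bestRisk_le_risk_seqRule s ε p) fun _ => le_rfl
    · refine NoisyTracking.measurable_timeToEReal_firstPassage (fun t => ?_) l
      have := hN.measurable_obs s ε t
      unfold NoisyTracking.mmse
      fun_prop
    · rw [NoisyTracking.seqRule_obs]
      exact hE.ae_firstPassage_ne_top hs l
    · simp only [NoisyTracking.seqRule_obs]
      exact hE.tendsto_eLpNorm_firstPassage_sub hs hp hq
  have hsingle : Tendsto (fun l : ℝ =>
      NoisyTracking.risk P p s V l (fun ω => NoisyTracking.timeToEReal
        (NoisyTracking.singleRule s ε q (NoisyTracking.obs s ε V W) l ω)) /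
      NoisyTracking.C1 l s ε p) atTop (𝓝 1) := by
    refine hN.tendsto_div_C1 hs hε hp hq
      (η := NoisyTracking.singleRule s ε q (NoisyTracking.obs s ε V W))
      (fun l => NoisyTracking.measurable_timeToEReal_singleRule (hN.measurable_obs s ε))
      (fun l => Eventually.of_forall fun ω => WithTop.coe_ne_top) ?_
      (NoisyTracking.IsGaussianNoise.bestRisk_le_risk_singleRule s ε p q) fun _ => le_rfl
    simp only [NoisyTracking.singleRule, NoisyTracking.mmse_obs, NoisyTracking.timeToEReal_coe,
      EReal.toReal_coe]
    exact hE.tendsto_eLpNorm_floor_sub hs hp hq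
  have hbest : Tendsto (fun l : ℝ =>
      NoisyTracking.bestRisk P p s ε V W l / NoisyTracking.C1 l s ε p) atTop (𝓝 1) := by
    refine hN.tendsto_div_C1 hs hε hp hq
      (η := NoisyTracking.singleRule s ε q (NoisyTracking.obs s ε V W))
      (fun l => NoisyTracking.measurable_timeToEReal_singleRule (hN.measurable_obs s ε))
      (fun l => Eventually.of_forall fun ω => WithTop.coe_ne_top) ?_ (fun _ => le_rfl)
      (NoisyTracking.IsGaussianNoise.bestRisk_le_risk_singleRule s ε p q)
    simp only [NoisyTracking.singleRule, NoisyTracking.mmse_obs, NoisyTracking.timeToEReal_coe,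
      EReal.toReal_coe]
    exact hE.tendsto_eLpNorm_floor_sub hs hp hq
  have hC : ∀ᶠ l in atTop, NoisyTracking.C1 l s ε p ≠ 0 ∧ NoisyTracking.C1 l s ε p ≠ ∞ :=
    (eventually_gt_atTop 0).mono fun l hl =>
      NoisyTracking.C1_ne_zero_and_ne_top hs hε (by linarith) hl
  exact ⟨fun l _ => ⟨NoisyTracking.isStoppingTime_seqRule hVm hWm s ε l,
    NoisyTracking.isStoppingTime_singleRule hVm hWm s ε q l⟩, hbest,
    NoisyTracking.tendsto_div_of_tendsto_div hseq hbest hC, hseq,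
    NoisyTracking.tendsto_div_of_tendsto_div hsingle hbest hC, hsingle⟩
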